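/- **Model.** Let $\sigma\in(0,1)$. The normalized perception gains of two fixed candidates (CoVs) $i\in\{1,2\}$ are $G_i(t+1)=f_I\bigl(G_i(t)+X_i(t)\bigr)$, $t=0,1,2,\dots$, where $f_I:\mathbb{R}\to[0,1]$ is the reflection $f_I(x)=x'$ if $x'<1$ and $f_I(x)=2-x'$ if $x'\ge 1$, with $x'\in[0,2)$, $x'\equiv x \pmod 2$. The increments $X_i(t)\sim\mathcal N(0,\sigma^2)$ and the initial states $G_i(0)$, uniform on $[0,1]$, are all mutually independent. In each slot $t=1,\dots,T$ one CoV $a_t\in\{1,2\}$ is scheduled, and then $G_{a_t}(t)$ is observed. The expected average learning regret of a scheduling algorithm $\mathcal A$ is $$\bar R_{\mathcal A}=\frac1T\,\mathbb E\Bigl[\sum_{t=1}^T\bigl(\max_i G_i(t)-G_{a_t}(t)\bigr)\Bigr].$$ MASS with parameter $\beta$ works as follows. If some CoV has not been scheduled before slot $t$, it schedules such a CoV. Otherwise it schedules a CoV maximizing $G_i(\tau_i)+\beta\sqrt{t-\tau_i}$, where $\tau_i<t$ is the last slot in which CoV $i$ was scheduled. Ties are broken arbitrarily (measurably). An online algorithm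 (possibly randomized) chooses $a_t$ as a measurable function of the past observations $(a_s,G_{a_s}(s))_{1\le s<t}$ and of an internal random element independent of all $G_i(0)$, $X_i(t)$. **Theorem (Fixed candidates).** 1. Let $\beta=15\,\sigma\log(1/\sigma)$. For every $\kappa>0$ there are $C>0$ and $\sigma_0\in(0,1)$, depending only on $\kappa$, such that for all $0<\sigma\le\sigma_0$ and all $T\ge\kappa\,\sigma^{-2}$, MASS satisfies $$\bar R_{\mathrm{MASS}}\le C\,\sigma^2\log^3(1/\sigma).$$ 2. There are absolute constants $c>0$ and $\sigma_0\in(0,1)$ such that for all $0<\sigma\le\sigma_0$ and all $T\ge1$, every online algorithm $\mathcal A$ satisfies $\bar R_{\mathcal A}\ge c\,\sigma^2$. So the bound in 1 is optimal up to a logarithmic factor. -/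

import Mathlib

universe u v

namespace MASS

open MeasureTheory ProbabilityTheory

/-- The reflection `f_I : ℝ → [0,1]`: with `x' ≡ x (mod 2)`, `x' ∈ [0,2)`, the value is `x'` if
`x' < 1` and `2 - x'` otherwise. Here `x'` is `2 * Int.fract (x / 2)`. -/
noncomputable def reflect (x : ℝ) : ℝ :=
  if 2 * Int.fract (x / 2) < 1 then 2 * Int.fract (x / 2) else 2 - 2 * Int.fract (x / 2)

/-- The random input of the two perception gains: the initial states `init i` are uniform on
`[0,1]`, the increments `X i t` have law `N(0, σ²)`, and all of these variables, over both CoVs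
and all times, are mutually independent. -/
structure IsInput {Ω : Type u} [MeasurableSpace Ω] (μ : Measure Ω) (σ : ℝ)
    (init : Fin 2 → Ω → ℝ) (X : Fin 2 → ℕ → Ω → ℝ) : Prop where
  measurable_init : ∀ i, Measurable (init i)
  measurable_increment : ∀ i t, Measurable (X i t)
  law_init : ∀ i, μ.map (init i) = volume.restrict (Set.Icc (0 : ℝ) 1)
  law_increment : ∀ i t, μ.map (X i t) = gaussianReal 0 (σ ^ 2).toNNReal
  indep : iIndepFun
    (Sum.elim init (fun p : Fin 2 × ℕ => X p.1 p.2) : Fin 2 ⊕ (Fin 2 × ℕ) → Ω → ℝ) μ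

/-- The normalized perception gains: Gaussian random walks reflected into `[0,1]`,
`G_i(0) = init i` and `G_i(t+1) = f_I (G_i(t) + X_i(t))`. -/
noncomputable def gain {Ω : Type u} (init : Fin 2 → Ω → ℝ) (X : Fin 2 → ℕ → Ω → ℝ) :
    Fin 2 → ℕ → Ω → ℝ
  | i, 0, ω => init i ω
  | i, t + 1, ω => reflect (gain init X i t ω + X i t ω)

/-- CoV `i` has not been scheduled in any of the slots `1, …, t - 1`. -/
def Unscheduled (a : ℕ → Fin 2) (i : Fin 2) (t : ℕ) : Prop :=
  ∀ s ∈ Finset.Ico 1 t, a s ≠ i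

/-- The last-seen time `τ_i` at the beginning of slot `t`: the largest `s` in `1, …, t - 1` with
`a s = i` (only used when there is such an `s`). -/
def lastSeen (a : ℕ → Fin 2) (i : Fin 2) (t : ℕ) : ℕ :=
  ((Finset.Ico 1 t).filter (fun s => a s = i)).sup id

/-- The upper confidence bound of CoV `i` in slot `t`: last-seen gain plus `β √(t - τ_i)`. -/
noncomputable def ucb (β : ℝ) (g : Fin 2 → ℕ → ℝ) (a : ℕ → Fin 2) (i : Fin 2) (t : ℕ) : ℝ :=
  g i (lastSeen a i t) + β * √((t : ℝ) - (lastSeen a i t : ℝ))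

/-- The schedule `a` is a run of MASS with parameter `β` during the slots `1, …, T`, on the gain
paths `g`: as long as some CoV has never been scheduled, such a CoV is scheduled; afterwards a CoV
with the largest upper confidence bound is scheduled. Both choices are free in case of ties. -/
def IsMASSRun (β : ℝ) (g : Fin 2 → ℕ → ℝ) (T : ℕ) (a : ℕ → Fin 2) : Prop :=
  ∀ t ∈ Finset.Icc 1 T,
    ((∃ i, Unscheduled a i t) → Unscheduled a (a t) t) ∧
    ((¬ ∃ i, Unscheduled a i t) → ∀ j, ucb β g a j t ≤ ucb β g a (a t) t)

/-- The learning regret `∑_{t=1}^T (G*(t) - G_{a_t}(t))`, where `G*(t) = max_i G_i(t)`. -/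
noncomputable def regret (g : Fin 2 → ℕ → ℝ) (T : ℕ) (a : ℕ → Fin 2) : ℝ :=
  ∑ t ∈ Finset.Icc 1 T, (max (g 0 t) (g 1 t) - g (a t) t)

/-- The learning regret by time `T` of the random schedule `a`, as a random variable. -/
noncomputable def regretRV {Ω : Type u} (G : Fin 2 → ℕ → Ω → ℝ) (T : ℕ) (a : ℕ → Ω → Fin 2)
    (ω : Ω) : ℝ :=
  regret (fun i t => G i t ω) T (fun t => a t ω)

/-- The expected average learning regret `E[R(T)] / T`. -/
noncomputable def avgRegret {Ω : Type u} [MeasurableSpace Ω] (μ : Measure Ω)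
    (G : Fin 2 → ℕ → Ω → ℝ) (T : ℕ) (a : ℕ → Ω → Fin 2) : ℝ :=
  (1 / (T : ℝ)) * ∫ ω, regretRV G T a ω ∂μ

/-- The schedule `a` is produced, during the slots `1, …, T`, by an online algorithm with internal
randomness `U`: in each slot `t` the choice is a measurable function of `U` and of the past
choices and observed gains `(a_s, G_{a_s}(s))`, `1 ≤ s < t`. -/
def IsOnline {Ω : Type u} {S : Type v} [MeasurableSpace S] (G : Fin 2 → ℕ → Ω → ℝ) (U : Ω → S)
    (T : ℕ) (a : ℕ → Ω → Fin 2) : Prop :=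
  ∀ t ∈ Finset.Icc 1 T, ∃ φ : S × (Set.Ico 1 t → Fin 2 × ℝ) → Fin 2, Measurable φ ∧
    ∀ ω, a t ω = φ (U ω, fun s => (a s ω, G (a s ω) s ω))

end MASS

/-! Upper bound. Call slot `t` good if over every lag `k` up to `t - 1` each gain has moved by at
most `β√k`. In a good slot the confidence bounds are valid, so scheduling a CoV last seen `n` slots
ago costs at most `2β√n`. If this cost is positive, the gap between the two gains was at most `4β√n`
in all of the last `n` slots. Hence each such slot `s` can pay `2β/√n ≤ 10β²/(β + gap_s)`, and
together they cover the cost (`IsMASSRun.slot_regret_le`). A slot pays at most once per CoV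
(`sum_sum_Ioc_lastSeen_le`).

The payments do not depend on the schedule. The uniform law is stationary (`map_reflect_add_prod`),
so at each time the gains are independent uniforms and `1/(β + gap)` has mean at most `2
log((β+1)/β)`. This gives `O(β² log(1/β))` per slot, which is of order `σ² log³(1/σ)`. Bad slots are
rare: displacements of a gain are dominated by those of an unfolded walk, whose steps are Gaussian
up to a predictable sign, so that it is sub-Gaussian with variance proxy `kσ²`.

Lower bound. Before any slot, with probability at least `σ/4`, the gains lie within `σ` of each
other and away from the boundary. The next increments are independent of this and of the choice.
With a fixed positive probability the scheduled gain falls and the other rises, each by more than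
`σ`, which leaves regret at least `σ` (`IsInput.le_integral_slot_regret`). -/

namespace MASS

open MeasureTheory ProbabilityTheory

/-! ### The reflection as distance to the even integers -/

section Reflection

/-- The orientation of the reflection at `x`: `reflect` has slope `flip x` there. -/
noncomputable def flip (x : ℝ) : ℝ := if 2 * Int.fract (x / 2) < 1 then 1 else -1

lemma flip_eq_or (x : ℝ) : flip x = 1 ∨ flip x = -1 := by
  unfold flip; split_ifs <;> simp

lemma reflect_nonneg (x : ℝ) : 0 ≤ reflect x := by
  unfold reflect
  have h0 := Int.fract_nonneg (x / 2)
  have h1 := Int.fract_lt_one (x / 2)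
  split_ifs <;> linarith

lemma reflect_le_one (x : ℝ) : reflect x ≤ 1 := by
  unfold reflect
  split_ifs <;> linarith

lemma exists_reflect_eq (x : ℝ) : ∃ k : ℤ, reflect x = flip x * x + 2 * k := by
  unfold reflect flip
  have h : Int.fract (x / 2) = x / 2 - ⌊x / 2⌋ := rfl
  split_ifs
  · exact ⟨-⌊x / 2⌋, by rw [h]; push_cast; ring⟩
  · exact ⟨1 + ⌊x / 2⌋, by rw [h]; push_cast; ring⟩

/-- Together with `exists_reflect_eq_abs_sub` this identifies `reflect x` with the distance from `x`
to `2ℤ`; the Lipschitz bound and evenness follow from that. -/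
lemma reflect_le_abs_sub (x : ℝ) (k : ℤ) : reflect x ≤ |x - 2 * k| := by
  have h : x = 2 * (⌊x / 2⌋ + Int.fract (x / 2)) := by
    rw [Int.floor_add_fract]; ring
  have h0 := Int.fract_nonneg (x / 2)
  have h1 := Int.fract_lt_one (x / 2)
  have hr : reflect x ≤ 2 * Int.fract (x / 2) ∧ reflect x ≤ 2 - 2 * Int.fract (x / 2) := by
    unfold reflect
    split_ifs <;> constructor <;> linarith
  rcases le_or_gt k ⌊x / 2⌋ with hk | hk
  · have : (k : ℝ) ≤ ⌊x / 2⌋ := by exact_mod_cast hk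
    refine le_trans ?_ (le_abs_self _)
    linarith
  · have : (⌊x / 2⌋ : ℝ) + 1 ≤ k := by exact_mod_cast hk
    refine le_trans ?_ (neg_le_abs _)
    linarith

lemma exists_reflect_eq_abs_sub (x : ℝ) : ∃ k : ℤ, reflect x = |x - 2 * k| := by
  obtain ⟨k, hk⟩ := exists_reflect_eq x
  rw [← abs_of_nonneg (reflect_nonneg x), hk]
  rcases flip_eq_or x with h | h
  · refine ⟨-k, ?_⟩
    rw [h]; push_cast; congr 1; ring
  · refine ⟨k, ?_⟩
    rw [h, ← abs_neg]; congr 1; ring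

lemma abs_reflect_sub_reflect_le (x y : ℝ) : |reflect x - reflect y| ≤ |x - y| := by
  have key : ∀ a b : ℝ, reflect a - reflect b ≤ |a - b| := by
    intro a b
    obtain ⟨k, hk⟩ := exists_reflect_eq_abs_sub b
    have h1 := reflect_le_abs_sub a k
    have h2 := abs_add_le (a - b) (b - 2 * k)
    rw [show a - b + (b - 2 * k) = a - 2 * k by ring] at h2
    linarith
  rw [abs_sub_le_iff]
  exact ⟨key x y, by rw [abs_sub_comm]; exact key y x⟩

lemma continuous_reflect : Continuous reflect := by
  refine LipschitzWith.continuous (K := 1) (LipschitzWith.of_dist_le_mul fun x y => ?_)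
  simpa [Real.dist_eq] using abs_reflect_sub_reflect_le x y

lemma measurable_reflect : Measurable reflect := continuous_reflect.measurable

lemma measurable_flip : Measurable flip := by
  unfold flip
  refine Measurable.ite ?_ measurable_const measurable_const
  exact measurableSet_lt ((measurable_fract.comp (measurable_id.div_const 2)).const_mul 2)
    measurable_const

lemma reflect_add_two_mul (x : ℝ) (k : ℤ) : reflect (x + 2 * k) = reflect x := by
  unfold reflect
  rw [show (x + 2 * k) / 2 = x / 2 + k by ring, Int.fract_add_intCast]

lemma reflect_neg (x : ℝ) : reflect (-x) = reflect x := by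
  have key : ∀ a : ℝ, reflect (-a) ≤ reflect a := by
    intro a
    obtain ⟨k, hk⟩ := exists_reflect_eq_abs_sub a
    rw [hk, ← abs_neg]
    convert reflect_le_abs_sub (-a) (-k) using 2
    push_cast; ring
  exact le_antisymm (key x) (by simpa using key (-x))

lemma reflect_of_mem {x : ℝ} (h0 : 0 ≤ x) (h1 : x ≤ 1) : reflect x = x := by
  rcases h1.lt_or_eq with h1 | rfl
  · have : Int.fract (x / 2) = x / 2 := Int.fract_eq_self.2 ⟨by linarith, by linarith⟩
    unfold reflect
    rw [this, if_pos (by linarith)]; ring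
  · have : Int.fract ((1 : ℝ) / 2) = 1 / 2 := Int.fract_eq_self.2 ⟨by norm_num, by norm_num⟩
    unfold reflect
    rw [this]; norm_num

/-- A reflected step is a step of the unfolded walk in the direction of the orientation. -/
lemma reflect_reflect_add (h x : ℝ) : reflect (reflect h + x) = reflect (h + flip h * x) := by
  obtain ⟨k, hk⟩ := exists_reflect_eq h
  rw [hk, show flip h * h + 2 * k + x = flip h * h + x + 2 * k by ring, reflect_add_two_mul]
  rcases flip_eq_or h with e | e
  · rw [e]; ring_nf
  · rw [e, ← reflect_neg]; ring_nf

end Reflection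

/-! ### Comparison of a gain with an unreflected walk -/

section UnfoldedWalk

/-- The walk started at `x₀` whose reflection is the reflected walk with increments `x`. -/
noncomputable def unfolded (x₀ : ℝ) (x : ℕ → ℝ) : ℕ → ℝ
  | 0 => x₀
  | k + 1 => unfolded x₀ x k + flip (unfolded x₀ x k) * x k

variable {Ω : Type u} {init : Fin 2 → Ω → ℝ} {X : Fin 2 → ℕ → Ω → ℝ}

lemma gain_succ (i : Fin 2) (t : ℕ) (ω : Ω) :
    gain init X i (t + 1) ω = reflect (gain init X i t ω + X i t ω) := rfl

/-- Slot 0 is excluded because the initial state lies in `[0,1]` only almost surely. -/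
lemma gain_nonneg {i : Fin 2} {t : ℕ} (ht : 1 ≤ t) (ω : Ω) : 0 ≤ gain init X i t ω := by
  obtain ⟨t, rfl⟩ := Nat.exists_eq_add_of_le' ht
  exact reflect_nonneg _

lemma gain_le_one {i : Fin 2} {t : ℕ} (ht : 1 ≤ t) (ω : Ω) : gain init X i t ω ≤ 1 := by
  obtain ⟨t, rfl⟩ := Nat.exists_eq_add_of_le' ht
  exact reflect_le_one _

lemma gain_add_eq_reflect_unfolded {i : Fin 2} {s : ℕ} (hs : 1 ≤ s) (k : ℕ) (ω : Ω) :
    gain init X i (s + k) ω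
      = reflect (unfolded (gain init X i s ω) (fun l => X i (s + l) ω) k) := by
  induction k with
  | zero => exact (reflect_of_mem (gain_nonneg hs ω) (gain_le_one hs ω)).symm
  | succ k ih =>
    rw [← add_assoc, gain_succ, ih, reflect_reflect_add]
    rfl

/-- Both gains are reflections of positions of the same unfolded walk, and `reflect` is 1-Lipschitz.
Tail bounds thus transfer from the walk to the gain. -/
lemma abs_gain_add_sub_le {i : Fin 2} {s : ℕ} (hs : 1 ≤ s) (k : ℕ) (ω : Ω) :
    |gain init X i (s + k) ω - gain init X i s ω|
      ≤ |unfolded (gain init X i s ω) (fun l => X i (s + l) ω) k - gain init X i s ω| := by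
  refine le_trans (le_of_eq ?_) (abs_reflect_sub_reflect_le _ _)
  rw [gain_add_eq_reflect_unfolded hs, reflect_of_mem (gain_nonneg hs ω) (gain_le_one hs ω)]

end UnfoldedWalk

/-! ### Independence of past and future inputs -/

section Independence

variable {Ω : Type u}

/-- The intersections of a set of `m₁` with a set of `m₂` form a π-system generating `m₁ ⊔ m₂`, and
on it the product formula is immediate. It serves to adjoin the internal randomness to the past. -/
lemma indep_sup_left [mΩ : MeasurableSpace Ω] {μ : Measure Ω} [IsZeroOrProbabilityMeasure μ] {m₁ m₂ m₃ : MeasurableSpace Ω}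
    (h₁ : m₁ ≤ mΩ) (h₂ : m₂ ≤ mΩ) (h₃ : m₃ ≤ mΩ)
    (h : Indep m₁ (m₂ ⊔ m₃) μ) (h' : Indep m₂ m₃ μ) : Indep (m₁ ⊔ m₂) m₃ μ := by
  refine IndepSets.indep (p1 := Set.image2 (· ∩ ·) {s | MeasurableSet[m₁] s}
    {s | MeasurableSet[m₂] s}) (p2 := {s | MeasurableSet[m₃] s}) (sup_le h₁ h₂) h₃ ?_
    (@MeasurableSpace.isPiSystem_measurableSet Ω m₃) ?_
    (@MeasurableSpace.generateFrom_measurableSet Ω m₃).symm ?_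
  · rintro _ ⟨a, ha, b, hb, rfl⟩ _ ⟨c, hc, d, hd, rfl⟩ -
    refine ⟨a ∩ c, MeasurableSet.inter ha hc, b ∩ d, MeasurableSet.inter hb hd, ?_⟩
    exact Set.inter_inter_inter_comm a c b d
  · refine le_antisymm (sup_le ?_ ?_) (MeasurableSpace.generateFrom_le ?_)
    · intro s hs
      exact MeasurableSpace.measurableSet_generateFrom
        ⟨s, hs, Set.univ, MeasurableSet.univ, Set.inter_univ s⟩
    · intro s hs
      exact MeasurableSpace.measurableSet_generateFrom
        ⟨Set.univ, MeasurableSet.univ, s, hs, Set.univ_inter s⟩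
    · rintro _ ⟨a, ha, b, hb, rfl⟩
      exact MeasurableSet.inter ((le_sup_left : m₁ ≤ m₁ ⊔ m₂) a ha)
        ((le_sup_right : m₂ ≤ m₁ ⊔ m₂) b hb)
  · rw [IndepSets_iff]
    rintro _ c ⟨a, ha, b, hb, rfl⟩ hc
    rw [Indep_iff] at h h'
    have hb' := (le_sup_left : m₂ ≤ m₂ ⊔ m₃) b hb
    have hc' := (le_sup_right : m₃ ≤ m₂ ⊔ m₃) c hc
    change μ (a ∩ b ∩ c) = μ (a ∩ b) * μ c
    rw [Set.inter_assoc, h a _ ha (MeasurableSet.inter hb' hc'), h' b c hb hc, h a b ha hb',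
      mul_assoc]

/-- All the random inputs as one family. -/
def inputs (init : Fin 2 → Ω → ℝ) (X : Fin 2 → ℕ → Ω → ℝ) : Fin 2 ⊕ (Fin 2 × ℕ) → Ω → ℝ :=
  Sum.elim init (fun p => X p.1 p.2)

/-- The σ-algebra generated by the inputs with index in `I`. -/
@[reducible] def inputSigma (init : Fin 2 → Ω → ℝ) (X : Fin 2 → ℕ → Ω → ℝ) (I : Set (Fin 2 ⊕ (Fin 2 × ℕ))) :
    MeasurableSpace Ω :=
  ⨆ p ∈ I, MeasurableSpace.comap (inputs init X p) inferInstance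

/-- The inputs that determine the gain of CoV `i` in slot `t`. -/
def gainIdx (i : Fin 2) (t : ℕ) : Set (Fin 2 ⊕ (Fin 2 × ℕ)) :=
  {p | p = Sum.inl i ∨ ∃ s < t, p = Sum.inr (i, s)}

/-- The inputs that determine the gains of both CoVs in slot `t`. -/
def pastIdx (t : ℕ) : Set (Fin 2 ⊕ (Fin 2 × ℕ)) := ⋃ i, gainIdx i t

variable {init : Fin 2 → Ω → ℝ} {X : Fin 2 → ℕ → Ω → ℝ} {σ : ℝ}

lemma inputSigma_mono {I J : Set (Fin 2 ⊕ (Fin 2 × ℕ))} (h : I ⊆ J) :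
    inputSigma init X I ≤ inputSigma init X J :=
  biSup_mono h

lemma gainIdx_mono (i : Fin 2) {s t : ℕ} (h : s ≤ t) : gainIdx i s ⊆ gainIdx i t := by
  rintro p (hp | ⟨r, hr, hp⟩)
  · exact Or.inl hp
  · exact Or.inr ⟨r, by omega, hp⟩

lemma pastIdx_mono {s t : ℕ} (h : s ≤ t) : pastIdx s ⊆ pastIdx t :=
  Set.iUnion_mono fun i => gainIdx_mono i h

lemma gainIdx_subset_pastIdx (i : Fin 2) (t : ℕ) : gainIdx i t ⊆ pastIdx t :=
  Set.subset_iUnion (fun i => gainIdx i t) i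

lemma measurable_inputs_inputSigma {I : Set (Fin 2 ⊕ (Fin 2 × ℕ))} {p : Fin 2 ⊕ (Fin 2 × ℕ)}
    (hp : p ∈ I) : Measurable[inputSigma init X I] (inputs init X p) := by
  rw [measurable_iff_comap_le]
  exact le_biSup (fun p => MeasurableSpace.comap (inputs init X p) inferInstance) hp

lemma measurable_gain_inputSigma (i : Fin 2) (t : ℕ) :
    Measurable[inputSigma init X (gainIdx i t)] (gain init X i t) := by
  induction t with
  | zero => exact measurable_inputs_inputSigma (p := Sum.inl i) (Or.inl rfl)
  | succ t ih =>
    have h1 : Measurable[inputSigma init X (gainIdx i (t + 1))] (gain init X i t) :=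
      ih.mono (inputSigma_mono (gainIdx_mono i (Nat.le_succ t))) le_rfl
    have h2 : Measurable[inputSigma init X (gainIdx i (t + 1))] (X i t) :=
      measurable_inputs_inputSigma (p := Sum.inr (i, t)) (Or.inr ⟨t, Nat.lt_succ_self t, rfl⟩)
    exact measurable_reflect.comp (h1.add h2)

lemma measurable_gain_pastIdx {i : Fin 2} {s t : ℕ} (h : s ≤ t) :
    Measurable[inputSigma init X (pastIdx t)] (gain init X i s) :=
  (measurable_gain_inputSigma i s).mono
    (inputSigma_mono ((gainIdx_subset_pastIdx i s).trans (pastIdx_mono h))) le_rfl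

lemma measurable_increment_pastIdx {i : Fin 2} {s t : ℕ} (h : s < t) :
    Measurable[inputSigma init X (pastIdx t)] (X i s) :=
  measurable_inputs_inputSigma (p := Sum.inr (i, s))
    (gainIdx_subset_pastIdx i t (Or.inr ⟨s, h, rfl⟩))

variable [mΩ : MeasurableSpace Ω] {μ : Measure Ω}

lemma IsInput.measurable_inputs (h : IsInput μ σ init X) (p : Fin 2 ⊕ (Fin 2 × ℕ)) :
    Measurable (inputs init X p) := by
  rcases p with i | ⟨i, t⟩
  · exact h.measurable_init i
  · exact h.measurable_increment i t

lemma IsInput.inputSigma_le (h : IsInput μ σ init X) (I : Set (Fin 2 ⊕ (Fin 2 × ℕ))) :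
    inputSigma init X I ≤ mΩ :=
  iSup₂_le fun p _ => (h.measurable_inputs p).comap_le

lemma IsInput.indep_inputSigma (h : IsInput μ σ init X) {I J : Set (Fin 2 ⊕ (Fin 2 × ℕ))}
    (hIJ : Disjoint I J) : Indep (inputSigma init X I) (inputSigma init X J) μ :=
  indep_iSup_of_disjoint (fun p => (h.measurable_inputs p).comap_le) h.indep hIJ

lemma indepFun_of_indep {α β : Type*} {mα : MeasurableSpace α} {mβ : MeasurableSpace β}
    {m₁ m₂ : MeasurableSpace Ω} (h : Indep m₁ m₂ μ) {f : Ω → α} {g : Ω → β}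
    (hf : Measurable[m₁] f) (hg : Measurable[m₂] g) : IndepFun f g μ :=
  indep_of_indep_of_le_left (indep_of_indep_of_le_right h hg.comap_le) hf.comap_le

lemma IsInput.measurable_gain (h : IsInput μ σ init X) (i : Fin 2) (t : ℕ) :
    Measurable (gain init X i t) :=
  (measurable_gain_inputSigma i t).mono (h.inputSigma_le _) le_rfl

lemma disjoint_gainIdx (s t : ℕ) : Disjoint (gainIdx 0 s) (gainIdx 1 t) := by
  rw [Set.disjoint_left]
  rintro p (rfl | ⟨a, -, rfl⟩) (hp | ⟨b, -, hp⟩) <;> simp at hp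

lemma disjoint_pastIdx (t : ℕ) : Disjoint (pastIdx t) {p | ∃ i, p = Sum.inr (i, t)} := by
  rw [Set.disjoint_left]
  rintro p hp ⟨i, rfl⟩
  obtain ⟨j, hj | ⟨s, hs, hj⟩⟩ := Set.mem_iUnion.1 hp
  · simp at hj
  · simp only [Sum.inr.injEq, Prod.mk.injEq] at hj
    omega

lemma IsInput.indepFun_gain (h : IsInput μ σ init X) (t : ℕ) :
    IndepFun (gain init X 0 t) (gain init X 1 t) μ :=
  indepFun_of_indep (h.indep_inputSigma (disjoint_gainIdx t t))
    (measurable_gain_inputSigma 0 t) (measurable_gain_inputSigma 1 t)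

lemma IsInput.indepFun_past_increment (h : IsInput μ σ init X) {i : Fin 2} {t : ℕ} {α : Type*}
    [MeasurableSpace α] {f : Ω → α} (hf : Measurable[inputSigma init X (pastIdx t)] f) :
    IndepFun f (X i t) μ :=
  indepFun_of_indep (h.indep_inputSigma (disjoint_pastIdx t)) hf
    (measurable_inputs_inputSigma (p := Sum.inr (i, t)) ⟨i, rfl⟩)

end Independence

/-! ### Stationarity of the uniform law -/

section Stationarity

/-- The function `f ∘ reflect` is even and 2-periodic. By evenness the two shifted integrals run
over `[x, x+1]` and `[x-1, x]`, which make up one full period, and a period is two copies of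
`[0,1]`. -/
lemma integral_comp_reflect_add_add_integral {f : ℝ → ℝ} (hf : Measurable f) {K : ℝ}
    (hK : ∀ x, |f x| ≤ K) (x : ℝ) :
    (∫ u in (0 : ℝ)..1, f (reflect (u + x))) + ∫ u in (0 : ℝ)..1, f (reflect (u - x))
      = 2 * ∫ u in (0 : ℝ)..1, f u := by
  set F : ℝ → ℝ := fun u => f (reflect u) with hF
  have hint : ∀ a b, IntervalIntegrable F volume a b := fun a b =>
    (intervalIntegrable_const (c := K)).mono_fun
      (hf.comp measurable_reflect).aestronglyMeasurable
      (Filter.Eventually.of_forall fun u => by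
        simpa using (hK (reflect u)).trans (le_abs_self K))
  have hper : Function.Periodic F 2 := fun u => by
    have := reflect_add_two_mul u 1
    simp only [Int.cast_one, mul_one] at this
    simp only [hF, this]
  have h1 : ∫ u in (0 : ℝ)..1, F (u + x) = ∫ u in x..x + 1, F u := by
    rw [intervalIntegral.integral_comp_add_right]; congr 1 <;> ring
  have h2 : ∫ u in (0 : ℝ)..1, F (u - x) = ∫ u in (x - 1)..x, F u := by
    have : ∀ u, F (u - x) = F (x - u) := fun u => by
      simp only [hF]; rw [← reflect_neg, neg_sub]
    simp_rw [this]
    rw [intervalIntegral.integral_comp_sub_left]; congr 1; ring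
  have h3 : ∫ u in (-1 : ℝ)..0, F u = ∫ u in (0 : ℝ)..1, F u := by
    have : ∀ u, F (-u) = F u := fun u => by simp only [hF, reflect_neg]
    have hc := intervalIntegral.integral_comp_neg (a := 0) (b := 1) F
    simp only [this, neg_zero] at hc
    exact hc.symm
  have h4 : ∫ u in (0 : ℝ)..1, F u = ∫ u in (0 : ℝ)..1, f u := by
    refine intervalIntegral.integral_congr fun u hu => ?_
    rw [Set.uIcc_of_le zero_le_one] at hu
    simp only [hF, reflect_of_mem hu.1 hu.2]
  change (∫ u in (0 : ℝ)..1, F (u + x)) + ∫ u in (0 : ℝ)..1, F (u - x) = _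
  rw [h1, h2, add_comm, intervalIntegral.integral_add_adjacent_intervals (hint _ _) (hint _ _)]
  have h5 := hper.intervalIntegral_add_eq (x - 1) (-1)
  rw [show x - 1 + 2 = x + 1 by ring, show (-1 : ℝ) + 2 = 1 by norm_num] at h5
  rw [h5, ← intervalIntegral.integral_add_adjacent_intervals (hint (-1) 0) (hint 0 1), h3, h4]
  ring

lemma restrict_Icc_preimage_eq {B : Set ℝ} (hB : MeasurableSet B) {g : ℝ → ℝ}
    (hg : Measurable g) :
    volume.restrict (Set.Icc (0 : ℝ) 1) (g ⁻¹' B)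
      = ENNReal.ofReal (∫ u in (0 : ℝ)..1, B.indicator (fun _ => (1 : ℝ)) (g u)) := by
  have : ∀ u, B.indicator (fun _ => (1 : ℝ)) (g u)
      = (g ⁻¹' B).indicator (fun _ => (1 : ℝ)) u := fun u => rfl
  simp_rw [this]
  rw [intervalIntegral.integral_of_le zero_le_one, ← integral_Icc_eq_integral_Ioc,
    integral_indicator (hg hB), setIntegral_const, smul_eq_mul, mul_one, measureReal_def,
    ENNReal.ofReal_toReal (measure_ne_top _ _)]

/-- The uniform law on `[0,1]` is invariant under a reflected symmetric step. -/
lemma map_reflect_add_prod {γ : Measure ℝ} [IsProbabilityMeasure γ]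
    (hγ : γ.map (fun x => -x) = γ) :
    ((volume.restrict (Set.Icc (0 : ℝ) 1)).prod γ).map (fun p => reflect (p.1 + p.2))
      = volume.restrict (Set.Icc (0 : ℝ) 1) := by
  have hm : Measurable fun p : ℝ × ℝ => reflect (p.1 + p.2) :=
    measurable_reflect.comp (measurable_fst.add measurable_snd)
  ext B hB
  rw [Measure.map_apply hm hB, Measure.prod_apply_symm (hm hB)]
  set ν := volume.restrict (Set.Icc (0 : ℝ) 1) with hν
  set h : ℝ → ENNReal := fun x => ν ((fun u => (u, x)) ⁻¹' ((fun p => reflect (p.1 + p.2)) ⁻¹' B))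
    with hh
  have hmeas : Measurable h := measurable_measure_prodMk_right (hm hB)
  -- A deterministic shift need not preserve the uniform law; only the average over the steps `x`
  -- and `-x` does. The symmetry of `γ` is what allows this pairing.
  have hsum : ∀ x, h x + h (-x) = 2 * ν B := by
    intro x
    have e1 : ∀ x, h x = ν ((fun u => reflect (u + x)) ⁻¹' B) := fun x => rfl
    have e2 : ν B = ν ((fun u => u) ⁻¹' B) := rfl
    have hm' : ∀ x, Measurable fun u : ℝ => reflect (u + x) := fun x =>
      measurable_reflect.comp (measurable_id.add_const x)
    have hpos : ∀ g : ℝ → ℝ,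
        0 ≤ ∫ u in (0 : ℝ)..1, B.indicator (fun _ => (1 : ℝ)) (g u) := fun g =>
      intervalIntegral.integral_nonneg zero_le_one fun u _ =>
        Set.indicator_nonneg (fun _ _ => zero_le_one) _
    rw [e1, e1, e2, hν, restrict_Icc_preimage_eq hB (hm' x), restrict_Icc_preimage_eq hB (hm' _),
      restrict_Icc_preimage_eq hB measurable_id', ← ENNReal.ofReal_add (hpos _) (hpos _)]
    simp_rw [← sub_eq_add_neg]
    rw [integral_comp_reflect_add_add_integral (K := 1) (measurable_const.indicator hB),
      ENNReal.ofReal_mul (by norm_num), ENNReal.ofReal_ofNat]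
    intro x
    by_cases hx : x ∈ B <;> simp [hx]
  have hneg : ∫⁻ x, h (-x) ∂γ = ∫⁻ x, h x ∂γ := by
    conv_rhs => rw [← hγ]
    rw [lintegral_map hmeas measurable_neg]
  have h2 : 2 * ∫⁻ x, h x ∂γ = 2 * ν B := by
    rw [two_mul]
    nth_rw 2 [← hneg]
    rw [← lintegral_add_left hmeas]
    simp_rw [hsum]
    simp
  exact (ENNReal.mul_right_inj (by norm_num) (by norm_num)).1 h2

variable {Ω : Type u} [mΩ : MeasurableSpace Ω] {μ : Measure Ω} [IsProbabilityMeasure μ]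
  {init : Fin 2 → Ω → ℝ} {X : Fin 2 → ℕ → Ω → ℝ} {σ : ℝ}

lemma IsInput.map_gain (h : IsInput μ σ init X) (i : Fin 2) (t : ℕ) :
    μ.map (gain init X i t) = volume.restrict (Set.Icc (0 : ℝ) 1) := by
  induction t with
  | zero => exact h.law_init i
  | succ t ih =>
    have hind : IndepFun (gain init X i t) (X i t) μ :=
      h.indepFun_past_increment (measurable_gain_pastIdx le_rfl)
    rw [indepFun_iff_map_prod_eq_prod_map_map (h.measurable_gain i t).aemeasurable
      (h.measurable_increment i t).aemeasurable, ih, h.law_increment] at hind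
    have hm : Measurable fun p : ℝ × ℝ => reflect (p.1 + p.2) :=
      measurable_reflect.comp (measurable_fst.add measurable_snd)
    have := map_reflect_add_prod (γ := gaussianReal 0 (σ ^ 2).toNNReal)
      (by rw [gaussianReal_map_neg, neg_zero])
    rw [← hind, Measure.map_map hm
      ((h.measurable_gain i t).prodMk (h.measurable_increment i t))] at this
    exact this

lemma IsInput.map_gain_prod (h : IsInput μ σ init X) (t : ℕ) :
    μ.map (fun ω => (gain init X 0 t ω, gain init X 1 t ω))
      = (volume.restrict (Set.Icc (0 : ℝ) 1)).prod (volume.restrict (Set.Icc (0 : ℝ) 1)) := by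
  have := h.indepFun_gain t
  rwa [indepFun_iff_map_prod_eq_prod_map_map (h.measurable_gain 0 t).aemeasurable
      (h.measurable_gain 1 t).aemeasurable, h.map_gain, h.map_gain] at this

end Stationarity

/-! ### The mean of the inverse gap -/

section Gap

lemma integral_one_div_add_abs_sub_le {b v : ℝ} (hb : 0 < b) (h0 : 0 ≤ v) (h1 : v ≤ 1) :
    ∫ u in (0 : ℝ)..1, 1 / (b + |u - v|) ≤ 2 * Real.log ((b + 1) / b) := by
  have hcont : Continuous fun u : ℝ => 1 / (b + |u - v|) :=
    continuous_const.div (by fun_prop) fun u => by positivity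
  rw [← intervalIntegral.integral_add_adjacent_intervals
    (hcont.intervalIntegrable 0 v) (hcont.intervalIntegrable v 1)]
  have e1 : ∫ u in (0 : ℝ)..v, 1 / (b + |u - v|) = Real.log ((b + v) / b) := by
    have : ∫ u in (0 : ℝ)..v, 1 / (b + |u - v|)
        = ∫ u in (0 : ℝ)..v, (fun x => 1 / x) (b + v - u) := by
      refine intervalIntegral.integral_congr fun u hu => ?_
      rw [Set.uIcc_of_le h0] at hu
      simp only
      rw [abs_of_nonpos (by linarith [hu.2])]
      congr 1; ring
    rw [this, intervalIntegral.integral_comp_sub_left, sub_zero, add_sub_cancel_right,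
      integral_one_div_of_pos hb (by linarith)]
  have e2 : ∫ u in v..(1 : ℝ), 1 / (b + |u - v|) = Real.log ((b + (1 - v)) / b) := by
    have : ∫ u in v..(1 : ℝ), 1 / (b + |u - v|)
        = ∫ u in v..(1 : ℝ), (fun x => 1 / x) (u + (b - v)) := by
      refine intervalIntegral.integral_congr fun u hu => ?_
      rw [Set.uIcc_of_le h1] at hu
      simp only
      rw [abs_of_nonneg (by linarith [hu.1])]
      congr 1; ring
    rw [this, intervalIntegral.integral_comp_add_right, show v + (b - v) = b by ring,
      show 1 + (b - v) = b + (1 - v) by ring, integral_one_div_of_pos hb (by linarith)]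
  have m : ∀ w, 0 ≤ w → w ≤ 1 → Real.log ((b + w) / b) ≤ Real.log ((b + 1) / b) := by
    intro w hw0 hw1
    refine Real.log_le_log (by positivity) ?_
    gcongr
  rw [e1, e2]
  linarith [m v h0 h1, m (1 - v) (by linarith) (by linarith)]

variable {Ω : Type u} [mΩ : MeasurableSpace Ω] {μ : Measure Ω} [IsProbabilityMeasure μ]
  {init : Fin 2 → Ω → ℝ} {X : Fin 2 → ℕ → Ω → ℝ} {σ : ℝ}

/-- The two gains are independent uniforms, so the bound holds conditionally on the value of one of
them. The growth in `b` is only logarithmic, which costs one factor `log(1/σ)` in the end. -/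
lemma IsInput.integral_one_div_add_gap_le (h : IsInput μ σ init X) {b : ℝ} (hb : 0 < b) (t : ℕ) :
    ∫ ω, 1 / (b + |gain init X 0 t ω - gain init X 1 t ω|) ∂μ
      ≤ 2 * Real.log ((b + 1) / b) := by
  set ν := volume.restrict (Set.Icc (0 : ℝ) 1) with hν
  have : IsProbabilityMeasure ν := ⟨by simp [hν]⟩
  have hcont : Continuous fun p : ℝ × ℝ => 1 / (b + |p.1 - p.2|) :=
    continuous_const.div (by fun_prop) fun u => by positivity
  have hle : ∀ p : ℝ × ℝ, ‖1 / (b + |p.1 - p.2|)‖ ≤ 1 / b := fun p => by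
    rw [Real.norm_of_nonneg (by positivity)]
    gcongr
    linarith [abs_nonneg (p.1 - p.2)]
  have hint : Integrable (fun p : ℝ × ℝ => 1 / (b + |p.1 - p.2|)) (ν.prod ν) :=
    (integrable_const (1 / b)).mono' hcont.measurable.aestronglyMeasurable
      (Filter.Eventually.of_forall hle)
  have e : ∫ ω, 1 / (b + |gain init X 0 t ω - gain init X 1 t ω|) ∂μ
      = ∫ p, 1 / (b + |p.1 - p.2|) ∂(ν.prod ν) := by
    rw [← h.map_gain_prod t, integral_map
      ((h.measurable_gain 0 t).prodMk (h.measurable_gain 1 t)).aemeasurable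
      hcont.measurable.aestronglyMeasurable]
  rw [e, integral_prod_symm _ hint]
  have hae : ∀ᵐ v ∂ν, ∫ u, 1 / (b + |u - v|) ∂ν ≤ 2 * Real.log ((b + 1) / b) := by
    rw [hν]
    refine (ae_restrict_iff' measurableSet_Icc).2 (Filter.Eventually.of_forall fun v hv => ?_)
    rw [integral_Icc_eq_integral_Ioc, ← intervalIntegral.integral_of_le zero_le_one]
    exact integral_one_div_add_abs_sub_le hb hv.1 hv.2
  calc _ ≤ ∫ _, 2 * Real.log ((b + 1) / b) ∂ν :=
        integral_mono_ae hint.integral_prod_right (integrable_const _) hae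
    _ = _ := by simp

end Gap

/-! ### Sub-Gaussian tails of the displacements -/

section Tail

lemma measurable_unfolded_pastIdx {Ω : Type u} {init : Fin 2 → Ω → ℝ}
    {X : Fin 2 → ℕ → Ω → ℝ} (i : Fin 2) (s k : ℕ) :
    Measurable[inputSigma init X (pastIdx (s + k))]
      (fun ω => unfolded (gain init X i s ω) (fun l => X i (s + l) ω) k) := by
  induction k with
  | zero => exact measurable_gain_pastIdx le_rfl
  | succ k ih =>
    have h1 := ih.mono (inputSigma_mono (pastIdx_mono (Nat.le_succ (s + k)))) le_rfl
    have h2 : Measurable[inputSigma init X (pastIdx (s + (k + 1)))] (X i (s + k)) :=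
      measurable_increment_pastIdx (by omega)
    exact h1.add ((measurable_flip.comp h1).mul h2)

variable {Ω : Type u} [mΩ : MeasurableSpace Ω] {μ : Measure Ω} [IsProbabilityMeasure μ]
  {init : Fin 2 → Ω → ℝ} {X : Fin 2 → ℕ → Ω → ℝ} {σ : ℝ}

omit [IsProbabilityMeasure μ] in
open Real in
/-- Adding an independent centred Gaussian increment with a predictable sign. -/
lemma hasSubgaussianMGF_add_sign_mul {D e Y : Ω → ℝ} {c v : NNReal}
    (hD : HasSubgaussianMGF D c μ) (hDm : Measurable D) (hem : Measurable e)
    (he : ∀ ω, e ω = 1 ∨ e ω = -1) (hY : μ.map Y = gaussianReal 0 v)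
    (hind : IndepFun (fun ω => (D ω, e ω)) Y μ) :
    HasSubgaussianMGF (fun ω => D ω + e ω * Y ω) (c + v) μ := by
  have hmgf : ∀ t : ℝ, ∫ ω, exp (t * Y ω) ∂μ = exp (v * t ^ 2 / 2) := fun t => by
    have := mgf_gaussianReal hY t
    rw [zero_mul, zero_add] at this
    exact this
  have hintY : ∀ t : ℝ, Integrable (fun ω => exp (t * Y ω)) μ := fun t => by
    -- A non-integrable function has integral 0 by convention, but the moment generating function is
    -- positive.
    by_contra hcon
    have := hmgf t
    rw [integral_undef hcon] at this
    exact (exp_pos _).ne this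
  have hset : ∀ r : ℝ, MeasurableSet {p : ℝ × ℝ | p.2 = r} := fun r =>
    measurable_snd (measurableSet_singleton r)
  have hfm : ∀ t r : ℝ, Measurable
      ({p : ℝ × ℝ | p.2 = r}.indicator fun p => exp (t * p.1)) := fun t r =>
    (measurable_exp.comp (measurable_fst.const_mul t)).indicator (hset r)
  -- Splitting by the value `r` of the sign replaces conditioning: on each piece the new factor is
  -- `exp (±t * Y)`, independent of the piece, and its mean is even in `t`.
  set A : ℝ → ℝ → Ω → ℝ := fun t r ω =>
    ({p : ℝ × ℝ | p.2 = r}.indicator fun p => exp (t * p.1)) (D ω, e ω) with hA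
  have hAint : ∀ t r, Integrable (A t r) μ := fun t r => by
    refine (hD.integrable_exp_mul t).mono'
      ((hfm t r).comp (hDm.prodMk hem)).aestronglyMeasurable (Filter.Eventually.of_forall fun ω => ?_)
    by_cases hr : e ω = r <;> simp [hA, hr, (exp_pos _).le]
  have hAB : ∀ t r s, IndepFun (A t r) (fun ω => exp (s * Y ω)) μ := fun t r s =>
    hind.comp (hfm t r) (measurable_exp.comp (measurable_id.const_mul s))
  have hABint : ∀ t r s, Integrable (A t r * fun ω => exp (s * Y ω)) μ := fun t r s =>
    (hAB t r s).integrable_mul (hAint t r) (hintY s)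
  have hsplit : ∀ t, (fun ω => exp (t * (D ω + e ω * Y ω)))
      = (A t 1 * fun ω => exp (t * Y ω)) + A t (-1) * fun ω => exp (-t * Y ω) := fun t => by
    funext ω
    rcases he ω with h | h
    · simp [hA, h, ← exp_add, mul_add]
      norm_num
    · simp [hA, h, ← exp_add, mul_add, show ¬ (-1 : ℝ) = 1 by norm_num]
  have hsum : ∀ t, (fun ω => exp (t * D ω)) = A t 1 + A t (-1) := fun t => by
    funext ω
    rcases he ω with h | h
    · simp [hA, h]
      norm_num
    · simp [hA, h, show ¬ (-1 : ℝ) = 1 by norm_num]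
  refine ⟨fun t => ?_, fun t => ?_⟩
  · rw [hsplit t]
    exact (hABint t 1 t).add (hABint t (-1) (-t))
  · have hm := hD.mgf_le t
    rw [mgf, hsum t, integral_add' (hAint _ _) (hAint _ _)] at hm
    rw [mgf, hsplit t, integral_add' (hABint _ _ _) (hABint _ _ _),
      (hAB _ _ _).integral_mul_eq_mul_integral (hAint _ _).1 (hintY _).1,
      (hAB _ _ _).integral_mul_eq_mul_integral (hAint _ _).1 (hintY _).1, hmgf, hmgf, neg_sq,
      ← add_mul]
    calc _ ≤ exp (c * t ^ 2 / 2) * exp (v * t ^ 2 / 2) := by gcongr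
      _ = _ := by rw [← exp_add]; push_cast; congr 1; ring

lemma IsInput.hasSubgaussianMGF_unfolded (h : IsInput μ σ init X) (i : Fin 2) (s k : ℕ) :
    HasSubgaussianMGF (fun ω => unfolded (gain init X i s ω) (fun l => X i (s + l) ω) k
      - gain init X i s ω) (k * (σ ^ 2).toNNReal) μ := by
  induction k with
  | zero => simp [unfolded]
  | succ k ih =>
    have hu := measurable_unfolded_pastIdx (init := init) (X := X) i s k
    have hg : Measurable[inputSigma init X (pastIdx (s + k))] (gain init X i s) :=
      measurable_gain_pastIdx (Nat.le_add_right s k)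
    have hD := hu.sub hg
    have he := measurable_flip.comp hu
    have hle := h.inputSigma_le (pastIdx (s + k))
    have := hasSubgaussianMGF_add_sign_mul ih (hD.mono hle le_rfl) (he.mono hle le_rfl)
      (fun ω => flip_eq_or _) (h.law_increment i (s + k))
      (h.indepFun_past_increment (hD.prodMk he))
    convert this using 1
    · funext ω
      simp only [unfolded, Function.comp]
      ring
    · push_cast; ring

lemma IsInput.measureReal_gain_dev_le (h : IsInput μ σ init X) (hσ : 0 < σ) (i : Fin 2) {s : ℕ}
    (hs : 1 ≤ s) {k : ℕ} (hk : 1 ≤ k) {b : ℝ} (hb : 0 ≤ b) :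
    μ.real {ω | b * σ * √k ≤ |gain init X i (s + k) ω - gain init X i s ω|}
      ≤ 2 * Real.exp (-b ^ 2 / 2) := by
  have hk' : (0 : ℝ) < k := by exact_mod_cast hk
  have hsub := h.hasSubgaussianMGF_unfolded i s k
  have hε : 0 ≤ b * σ * √k := by positivity
  have h1 := hsub.measure_ge_le hε
  have h2 := hsub.neg.measure_ge_le hε
  have e : -(b * σ * √k) ^ 2 / (2 * ((k * (σ ^ 2).toNNReal : NNReal) : ℝ)) = -b ^ 2 / 2 := by
    rw [NNReal.coe_mul, Real.coe_toNNReal _ (sq_nonneg σ), mul_pow, mul_pow, Real.sq_sqrt hk'.le,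
      NNReal.coe_natCast]
    field_simp
  rw [e] at h1 h2
  refine (measureReal_mono (fun ω hω => ?_) (measure_ne_top _ _)).trans
    ((measureReal_union_le _ _).trans (by rw [two_mul]; exact add_le_add h1 h2))
  have := le_trans hω (abs_gain_add_sub_le hs k ω)
  exact le_abs.1 this

end Tail

/-! ### Pathwise charging of the regret of MASS -/

section Charging

variable {β : ℝ} {g : Fin 2 → ℕ → ℝ} {T : ℕ} {a : ℕ → Fin 2}

lemma le_lastSeen {i : Fin 2} {s t : ℕ} (hs : s ∈ Finset.Ico 1 t) (h : a s = i) :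
    s ≤ lastSeen a i t :=
  Finset.le_sup (f := id) (Finset.mem_filter.2 ⟨hs, h⟩)

lemma lastSeen_mem_Ico {i : Fin 2} {t : ℕ} (h : ¬ Unscheduled a i t) :
    lastSeen a i t ∈ Finset.Ico 1 t := by
  simp only [Unscheduled, not_forall, not_not] at h
  obtain ⟨s, hs, e⟩ := h
  obtain ⟨r, hr, hr'⟩ := Finset.exists_mem_eq_sup
    ((Finset.Ico 1 t).filter fun s => a s = i) ⟨s, Finset.mem_filter.2 ⟨hs, e⟩⟩ id
  have : lastSeen a i t = r := hr'
  rw [this]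
  exact (Finset.mem_filter.1 hr).1

lemma IsMASSRun.not_unscheduled (h : IsMASSRun β g T a) {t : ℕ} (ht : 3 ≤ t) (htT : t ≤ T)
    (i : Fin 2) : ¬ Unscheduled a i t := by
  have h2 := (h 2 (Finset.mem_Icc.2 ⟨by omega, by omega⟩)).1
  -- In slot 2 the CoV not chosen in slot 1 is still unscheduled, so the first two slots cover both.
  have h12 : a 1 ≠ a 2 := by
    refine h2 ⟨1 - a 1, fun s hs => ?_⟩ 1 (by simp)
    obtain rfl : s = 1 := by simp at hs; omega
    generalize a 1 = x
    revert x; decide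
  intro hi
  have e1 := hi 1 (by simp; omega)
  have e2 := hi 2 (by simp; omega)
  have key : ∀ i x y : Fin 2, x ≠ y → x ≠ i → y ≠ i → False := by decide
  exact key i _ _ h12 e1 e2

/-- On well-behaved paths, the regret of a slot is paid by the slots since the last visit of the
scheduled CoV, each of which pays in inverse proportion to its gap. -/
lemma IsMASSRun.slot_regret_le (h : IsMASSRun β g T a) (hβ : 0 < β) {t : ℕ} (ht : 3 ≤ t)
    (htT : t ≤ T)
    (hg : ∀ i, ∀ s, 1 ≤ s → s < t → |g i t - g i s| ≤ β * √((t : ℝ) - s)) :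
    max (g 0 t) (g 1 t) - g (a t) t
      ≤ ∑ s ∈ Finset.Ioc (lastSeen a (a t) t) t, 10 * β ^ 2 * (1 / (β + |g 0 s - g 1 s|)) := by
  have hnonneg : 0 ≤ ∑ s ∈ Finset.Ioc (lastSeen a (a t) t) t,
      10 * β ^ 2 * (1 / (β + |g 0 s - g 1 s|)) :=
    Finset.sum_nonneg fun s _ => by positivity
  have hns := h.not_unscheduled ht htT
  have hucb := (h t (Finset.mem_Icc.2 ⟨by omega, htT⟩)).2 (fun ⟨i, hi⟩ => hns i hi)
  set j := a t with hj
  set τ := lastSeen a j t with hτ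
  have hτm := Finset.mem_Ico.1 (lastSeen_mem_Ico (hns j))
  rw [← hτ] at hτm
  have hτt : (τ : ℝ) + 1 ≤ t := by exact_mod_cast hτm.2
  set n : ℝ := (t : ℝ) - τ with hn
  have hn1 : 1 ≤ n := by rw [hn]; linarith
  have hsn : 1 ≤ √n := Real.one_le_sqrt.2 hn1
  -- The gain of `i` is at most its confidence bound, hence at most that of `j`, which is `g j τ +
  -- β√n ≤ g j t + 2β√n`.
  have hub : ∀ i, g i t - g j t ≤ 2 * (β * √n) := by
    intro i
    have hi := Finset.mem_Ico.1 (lastSeen_mem_Ico (hns i))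
    have h1 := hucb i
    unfold ucb at h1
    have h2 := (abs_le.1 (hg i _ hi.1 hi.2)).2
    have h3 := (abs_le.1 (hg j _ hτm.1 hτm.2)).1
    rw [← hτ, ← hn] at h1
    rw [← hn] at h3
    linarith
  rcases le_or_gt (max (g 0 t) (g 1 t) - g j t) 0 with hr | hr
  · exact hr.trans hnonneg
  -- Positive regret means that the worse CoV was scheduled, so the regret is the gap.
  have habs : |g 0 t - g 1 t| = max (g 0 t) (g 1 t) - g j t := by
    have hj' : j = 0 ∨ j = 1 := by generalize j = x; revert x; decide
    rcases hj' with e | e <;> rw [e] at hr ⊢ <;>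
      rcases max_cases (g 0 t) (g 1 t) with ⟨m, m'⟩ | ⟨m, m'⟩ <;> rw [m] at hr ⊢
    · linarith
    · rw [abs_of_nonpos (by linarith)]; ring
    · rw [abs_of_nonneg (by linarith)]
    · linarith
  have hmax : max (g 0 t) (g 1 t) - g j t ≤ 2 * (β * √n) := by
    rcases max_choice (g 0 t) (g 1 t) with m | m <;> rw [m]
    exacts [hub 0, hub 1]
  have hpay : ∀ s ∈ Finset.Ioc τ t, 2 * β / √n ≤ 10 * β ^ 2 * (1 / (β + |g 0 s - g 1 s|)) := by
    intro s hs
    rw [Finset.mem_Ioc] at hs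
    -- The gap at `t` contributes `2β√n`, and each gain contributes `β√n` for its movement between
    -- `s` and `t`.
    have hgap : |g 0 s - g 1 s| ≤ 4 * (β * √n) := by
      rcases hs.2.eq_or_lt with rfl | hst
      · rw [habs]
        have : 0 ≤ β * √n := by positivity
        linarith
      · have hle : √((t : ℝ) - s) ≤ √n := by
          refine Real.sqrt_le_sqrt ?_
          have : (τ : ℝ) ≤ s := by exact_mod_cast hs.1.le
          rw [hn]; linarith
        have hle' := mul_le_mul_of_nonneg_left hle hβ.le
        have h0 := hg 0 s (by omega) hst
        have h1 := hg 1 s (by omega) hst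
        have h2 : |g 0 t - g 1 t| ≤ 2 * (β * √n) := habs ▸ hmax
        rw [abs_le] at h0 h1 h2 ⊢
        constructor <;> linarith
    have hpos : 0 < β + |g 0 s - g 1 s| := by positivity
    have h5 : β + |g 0 s - g 1 s| ≤ 5 * (β * √n) := by nlinarith
    rw [mul_one_div, div_le_div_iff₀ (by positivity) hpos]
    nlinarith
  calc max (g 0 t) (g 1 t) - g j t ≤ 2 * (β * √n) := hmax
    _ = ∑ s ∈ Finset.Ioc τ t, 2 * β / √n := by
        rw [Finset.sum_const, Nat.card_Ioc, nsmul_eq_mul, Nat.cast_sub hτm.2.le, ← hn]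
        have : n = √n * √n := (Real.mul_self_sqrt (by linarith)).symm
        field_simp
        rw [pow_two, ← this]
    _ ≤ _ := Finset.sum_le_sum hpay

/-- Intervals between consecutive visits to the same CoV are disjoint, so a slot lies in at most one
interval per CoV. For fixed `s` the map `a` is therefore injective on the slots charging `s`. -/
lemma sum_sum_Ioc_lastSeen_le (a : ℕ → Fin 2) (T : ℕ) {w : ℕ → ℝ} (hw : ∀ s, 0 ≤ w s) :
    ∑ t ∈ Finset.Icc 3 T, ∑ s ∈ Finset.Ioc (lastSeen a (a t) t) t, w s
      ≤ 2 * ∑ s ∈ Finset.Icc 1 T, w s := by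
  have h1 : ∀ t ∈ Finset.Icc 3 T, ∑ s ∈ Finset.Ioc (lastSeen a (a t) t) t, w s
      = ∑ s ∈ Finset.Icc 1 T, if lastSeen a (a t) t < s ∧ s ≤ t then w s else 0 := by
    intro t ht
    rw [Finset.mem_Icc] at ht
    rw [← Finset.sum_filter]
    refine Finset.sum_congr ?_ fun _ _ => rfl
    ext s
    simp only [Finset.mem_Ioc, Finset.mem_filter, Finset.mem_Icc]
    constructor
    · intro h; exact ⟨⟨by omega, by omega⟩, h⟩
    · exact fun h => h.2
  rw [Finset.sum_congr rfl h1, Finset.sum_comm, Finset.mul_sum]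
  refine Finset.sum_le_sum fun s hs => ?_
  rw [← Finset.sum_filter, Finset.sum_const, nsmul_eq_mul]
  refine mul_le_mul_of_nonneg_right ?_ (hw s)
  have hcard : ((Finset.Icc 3 T).filter fun t => lastSeen a (a t) t < s ∧ s ≤ t).card
      ≤ (Finset.univ : Finset (Fin 2)).card := by
    refine Finset.card_le_card_of_injOn a (fun _ _ => Finset.mem_coe.2 (Finset.mem_univ _)) ?_
    have key : ∀ t t', t < t' → 3 ≤ t → s ≤ t → lastSeen a (a t') t' < s → a t ≠ a t' := by
      intro t t' htt h3 hst hl e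
      have := le_lastSeen (a := a) (i := a t') (s := t) (t := t')
        (Finset.mem_Ico.2 ⟨by omega, htt⟩) e
      omega
    intro t ht t' ht' e
    simp only [Finset.coe_filter, Finset.mem_Icc, Set.mem_ofPred_eq] at ht ht'
    rcases lt_trichotomy t t' with hlt | heq | hlt
    · exact absurd e (key t t' hlt ht.1.1 ht.2.2 ht'.2.1)
    · exact heq
    · exact absurd e.symm (key t' t hlt ht'.1.1 ht'.2.2 ht.2.1)
  exact_mod_cast hcard

end Charging

/-! ### The upper bound for MASS -/

section UpperBound

lemma measurable_selected {Ω : Type*} {m : MeasurableSpace Ω} {G : Fin 2 → Ω → ℝ}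
    (hG : ∀ i, Measurable (G i)) {b : Ω → Fin 2} (hb : Measurable b) :
    Measurable fun ω => G (b ω) ω := by
  have : (fun ω => G (b ω) ω) = fun ω => if b ω = 0 then G 0 ω else G 1 ω := by
    funext ω
    have : b ω = 0 ∨ b ω = 1 := by generalize b ω = x; revert x; decide
    rcases this with e | e <;> simp [e]
  rw [this]
  exact Measurable.ite (hb (measurableSet_singleton 0)) (hG 0) (hG 1)

variable {Ω : Type u} [mΩ : MeasurableSpace Ω] {μ : Measure Ω} [IsProbabilityMeasure μ]
  {init : Fin 2 → Ω → ℝ} {X : Fin 2 → ℕ → Ω → ℝ} {σ : ℝ}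

omit [IsProbabilityMeasure μ] in
lemma IsInput.measurable_gain_comp (h : IsInput μ σ init X) {b : Ω → Fin 2} (hb : Measurable b)
    (t : ℕ) : Measurable fun ω => gain init X (b ω) t ω :=
  measurable_selected (fun i => h.measurable_gain i t) hb

lemma slot_regret_nonneg (g : Fin 2 → ℕ → ℝ) (j : Fin 2) (t : ℕ) :
    0 ≤ max (g 0 t) (g 1 t) - g j t := by
  have : j = 0 ∨ j = 1 := by revert j; decide
  rcases this with rfl | rfl <;> simp

omit mΩ in
lemma slot_regret_le_one (j : Fin 2) {t : ℕ} (ht : 1 ≤ t) (ω : Ω) :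
    max (gain init X 0 t ω) (gain init X 1 t ω) - gain init X j t ω ≤ 1 := by
  have h1 := max_le (gain_le_one (init := init) (X := X) (i := 0) ht ω)
    (gain_le_one (init := init) (X := X) (i := 1) ht ω)
  have h2 := gain_nonneg (init := init) (X := X) (i := j) ht ω
  linarith

lemma IsInput.integrable_slot_regret (h : IsInput μ σ init X) {b : Ω → Fin 2} (hb : Measurable b)
    {t : ℕ} (ht : 1 ≤ t) :
    Integrable (fun ω => max (gain init X 0 t ω) (gain init X 1 t ω) - gain init X (b ω) t ω) μ := by
  refine (integrable_const (1 : ℝ)).mono'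
    (((h.measurable_gain 0 t).max (h.measurable_gain 1 t)).sub
      (h.measurable_gain_comp hb t)).aestronglyMeasurable
    (Filter.Eventually.of_forall fun ω => ?_)
  rw [Real.norm_of_nonneg (slot_regret_nonneg (fun i t => gain init X i t ω) (b ω) t)]
  exact slot_regret_le_one _ ht ω

lemma IsInput.integrable_regretRV (h : IsInput μ σ init X) {T : ℕ} {a : ℕ → Ω → Fin 2}
    (ha : ∀ t ∈ Finset.Icc 1 T, Measurable (a t)) :
    Integrable (regretRV (gain init X) T a) μ :=
  integrable_finsetSum _ fun t ht =>
    h.integrable_slot_regret (ha t ht) (Finset.mem_Icc.1 ht).1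

/-- Some gain moved by at least `β √k` during the `k ≤ N` slots before `t`. -/
def largeMove (init : Fin 2 → Ω → ℝ) (X : Fin 2 → ℕ → Ω → ℝ) (β : ℝ) (N t : ℕ) : Set Ω :=
  ⋃ p ∈ (Finset.univ : Finset (Fin 2)) ×ˢ (Finset.Icc 1 N).filter (· < t),
    {ω | β * √(p.2 : ℝ) ≤ |gain init X p.1 t ω - gain init X p.1 (t - p.2) ω|}

omit [IsProbabilityMeasure μ] in
lemma IsInput.measurableSet_largeMove (h : IsInput μ σ init X) (β : ℝ) (N t : ℕ) :
    MeasurableSet (largeMove init X β N t) :=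
  Finset.measurableSet_biUnion _ fun p _ => measurableSet_le measurable_const
    ((h.measurable_gain p.1 t).sub (h.measurable_gain p.1 _)).abs

lemma IsInput.measureReal_largeMove_le (h : IsInput μ σ init X) (hσ : 0 < σ) {b : ℝ}
    (hb : 0 ≤ b) (N t : ℕ) :
    μ.real (largeMove init X (b * σ) N t) ≤ 4 * N * Real.exp (-b ^ 2 / 2) := by
  refine (measureReal_biUnion_finset_le _ _).trans ?_
  refine (Finset.sum_le_card_nsmul _ _ (2 * Real.exp (-b ^ 2 / 2)) fun p hp => ?_).trans ?_
  · simp only [Finset.mem_product, Finset.mem_filter, Finset.mem_Icc] at hp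
    obtain ⟨s, rfl⟩ := Nat.exists_eq_add_of_lt hp.2.2
    have := h.measureReal_gain_dev_le hσ p.1 (s := s + 1) (by omega) hp.2.1.1 hb
    rw [show p.2 + s + 1 = s + 1 + p.2 by omega, Nat.add_sub_cancel]
    exact this
  · have hcard : ((Finset.univ : Finset (Fin 2)) ×ˢ (Finset.Icc 1 N).filter (· < t)).card
        ≤ 2 * N := by
      rw [Finset.card_product, Finset.card_univ, Fintype.card_fin]
      exact Nat.mul_le_mul_left 2 ((Finset.card_filter_le _ _).trans (by simp))
    have hcard' : (((Finset.univ : Finset (Fin 2)) ×ˢ (Finset.Icc 1 N).filter (· < t)).card : ℝ)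
        ≤ 2 * N := by exact_mod_cast hcard
    rw [nsmul_eq_mul]
    have := mul_le_mul_of_nonneg_right hcard' (by positivity : 0 ≤ 2 * Real.exp (-b ^ 2 / 2))
    linarith

-- For lags `k > N` one has `β√k ≥ 1`, and no two gains in `[0,1]` differ by more. A union bound
-- over lags up to `N` is thus enough, uniformly in `T`.
omit mΩ in
lemma abs_gain_sub_le_of_notMem_largeMove {β : ℝ} (hβ : 0 < β) {N t : ℕ}
    (hN : 1 / β ^ 2 ≤ N + 1) {ω : Ω} (hω : ω ∉ largeMove init X β N t) (i : Fin 2) {s : ℕ}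
    (hs : 1 ≤ s) (hst : s < t) :
    |gain init X i t ω - gain init X i s ω| ≤ β * √((t : ℝ) - s) := by
  have hcast : (t : ℝ) - s = ((t - s : ℕ) : ℝ) := (Nat.cast_sub hst.le).symm
  rw [hcast]
  rcases le_or_gt (t - s) N with hk | hk
  · by_contra! hcon
    refine hω (Set.mem_iUnion₂.2 ⟨(i, t - s), ?_, ?_⟩)
    · simp only [Finset.mem_product, Finset.mem_univ, true_and, Finset.mem_filter, Finset.mem_Icc]
      omega
    · change β * √((t - s : ℕ) : ℝ) ≤ |gain init X i t ω - gain init X i (t - (t - s)) ω|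
      rw [Nat.sub_sub_self hst.le]
      exact hcon.le
  · have hk' : (N : ℝ) + 1 ≤ ((t - s : ℕ) : ℝ) := by exact_mod_cast hk
    have h1 : 1 ≤ β * √((t - s : ℕ) : ℝ) := by
      have h2 : 1 / β ≤ √((t - s : ℕ) : ℝ) := by
        refine Real.le_sqrt_of_sq_le ?_
        rw [div_pow, one_pow]
        linarith
      rwa [div_le_iff₀' hβ] at h2
    refine le_trans ?_ h1
    have a1 := gain_nonneg (init := init) (X := X) (i := i) hs ω
    have a2 := gain_le_one (init := init) (X := X) (i := i) hs ω
    have a3 := gain_nonneg (init := init) (X := X) (i := i) (hs.trans hst.le) ω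
    have a4 := gain_le_one (init := init) (X := X) (i := i) (hs.trans hst.le) ω
    rw [abs_le]; constructor <;> linarith

-- The first two slots cost at most 1 each, a bad slot costs at most 1, and good slots are charged
-- to the inverse gaps.
omit mΩ in
lemma regretRV_le {β : ℝ} (hβ : 0 < β) {N T : ℕ} (hN : 1 / β ^ 2 ≤ N + 1) {a : ℕ → Ω → Fin 2}
    {ω : Ω} (hrun : IsMASSRun β (fun i t => gain init X i t ω) T fun t => a t ω) :
    regretRV (gain init X) T a ω
      ≤ 2 + ∑ t ∈ Finset.Icc 1 T, (largeMove init X β N t).indicator (fun _ => (1 : ℝ)) ω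
        + 2 * ∑ t ∈ Finset.Icc 1 T,
            10 * β ^ 2 * (1 / (β + |gain init X 0 t ω - gain init X 1 t ω|)) := by
  set r : ℕ → ℝ := fun t =>
    max (gain init X 0 t ω) (gain init X 1 t ω) - gain init X (a t ω) t ω with hr
  set f : ℕ → ℝ := fun t => (largeMove init X β N t).indicator (fun _ => (1 : ℝ)) ω with hf
  set w : ℕ → ℝ := fun t =>
    10 * β ^ 2 * (1 / (β + |gain init X 0 t ω - gain init X 1 t ω|)) with hw
  have hw0 : ∀ t, 0 ≤ w t := fun t => by rw [hw]; positivity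
  have hf0 : ∀ t, 0 ≤ f t := fun t => Set.indicator_nonneg (fun _ _ => zero_le_one) _
  have hslot : ∀ t ∈ Finset.Icc 3 T,
      r t ≤ f t + ∑ s ∈ Finset.Ioc (lastSeen (fun t => a t ω) (a t ω) t) t, w s := by
    intro t ht
    rw [Finset.mem_Icc] at ht
    by_cases hω : ω ∈ largeMove init X β N t
    · have h1 : f t = 1 := Set.indicator_of_mem hω _
      have h2 : r t ≤ 1 := slot_regret_le_one _ (by omega) ω
      have h3 : 0 ≤ ∑ s ∈ Finset.Ioc (lastSeen (fun t => a t ω) (a t ω) t) t, w s :=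
        Finset.sum_nonneg fun s _ => hw0 s
      linarith
    · have := hrun.slot_regret_le hβ ht.1 ht.2 fun i s hs hst =>
        abs_gain_sub_le_of_notMem_largeMove hβ hN hω i hs hst
      exact this.trans (le_add_of_nonneg_left (hf0 t))
  have hsplit : ∑ t ∈ Finset.Icc 1 T, r t ≤ 2 + ∑ t ∈ Finset.Icc 3 T, r t := by
    have hsub : Finset.Icc 1 T ⊆ {1, 2} ∪ Finset.Icc 3 T := by
      intro t ht
      simp only [Finset.mem_Icc, Finset.mem_union, Finset.mem_insert, Finset.mem_singleton] at ht ⊢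
      omega
    have hr0 : ∀ t, 0 ≤ r t := fun t =>
      slot_regret_nonneg (fun i t => gain init X i t ω) (a t ω) t
    refine (Finset.sum_le_sum_of_subset_of_nonneg hsub fun t _ _ => hr0 t).trans ?_
    rw [Finset.sum_union (by
      rw [Finset.disjoint_left]
      intro t ht
      simp only [Finset.mem_Icc, Finset.mem_insert, Finset.mem_singleton] at ht ⊢
      omega), Finset.sum_pair (by norm_num)]
    have h1 : r 1 ≤ 1 := slot_regret_le_one _ le_rfl ω
    have h2 : r 2 ≤ 1 := slot_regret_le_one _ (by norm_num) ω
    linarith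
  have hfsum : ∑ t ∈ Finset.Icc 3 T, f t ≤ ∑ t ∈ Finset.Icc 1 T, f t :=
    Finset.sum_le_sum_of_subset_of_nonneg (Finset.Icc_subset_Icc_left (by norm_num))
      fun t _ _ => hf0 t
  have hsum := Finset.sum_le_sum hslot
  rw [Finset.sum_add_distrib] at hsum
  have hcharge := sum_sum_Ioc_lastSeen_le (fun t => a t ω) T hw0
  change ∑ t ∈ Finset.Icc 1 T, r t ≤ _
  linarith

lemma IsInput.integral_regretRV_le (h : IsInput μ σ init X) (hσ : 0 < σ) {b : ℝ} (hb : 0 < b)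
    {N T : ℕ} (hN : 1 / (b * σ) ^ 2 ≤ N + 1) {a : ℕ → Ω → Fin 2} (ha : ∀ t, Measurable (a t))
    (hrun : ∀ ω, IsMASSRun (b * σ) (fun i t => gain init X i t ω) T fun t => a t ω) :
    ∫ ω, regretRV (gain init X) T a ω ∂μ
      ≤ 2 + T * (4 * N * Real.exp (-b ^ 2 / 2))
        + 40 * T * ((b * σ) ^ 2 * Real.log ((b * σ + 1) / (b * σ))) := by
  set β := b * σ with hβdef
  have hβ : 0 < β := mul_pos hb hσ
  have hintf : ∀ t ∈ Finset.Icc 1 T,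
      Integrable ((largeMove init X β N t).indicator fun _ => (1 : ℝ)) μ := fun t _ =>
    (integrable_const 1).indicator (h.measurableSet_largeMove β N t)
  have hintw : ∀ t ∈ Finset.Icc 1 T, Integrable (fun ω =>
      10 * β ^ 2 * (1 / (β + |gain init X 0 t ω - gain init X 1 t ω|))) μ := fun t _ => by
    refine Integrable.const_mul ?_ _
    refine (integrable_const (1 / β)).mono' (Measurable.aestronglyMeasurable ?_)
      (Filter.Eventually.of_forall fun ω => ?_)
    · exact measurable_const.div
        (measurable_const.add ((h.measurable_gain 0 t).sub (h.measurable_gain 1 t)).abs)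
    · rw [Real.norm_of_nonneg (by positivity)]
      gcongr
      linarith [abs_nonneg (gain init X 0 t ω - gain init X 1 t ω)]
  have hF := integrable_finsetSum _ hintf
  have hW := integrable_finsetSum _ hintw
  have hF2 : Integrable (fun ω => 2 + ∑ t ∈ Finset.Icc 1 T,
      (largeMove init X β N t).indicator (fun _ => (1 : ℝ)) ω) μ := (integrable_const 2).add hF
  have hle : ∫ ω, regretRV (gain init X) T a ω ∂μ ≤ ∫ ω, (2
      + ∑ t ∈ Finset.Icc 1 T, (largeMove init X β N t).indicator (fun _ => (1 : ℝ)) ω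
        + 2 * ∑ t ∈ Finset.Icc 1 T,
            10 * β ^ 2 * (1 / (β + |gain init X 0 t ω - gain init X 1 t ω|))) ∂μ :=
    integral_mono (h.integrable_regretRV fun t _ => ha t)
      (hF2.add (hW.const_mul 2))
      fun ω => regretRV_le hβ hN (hrun ω)
  rw [integral_add hF2 (hW.const_mul 2),
    integral_add (integrable_const 2) hF, integral_const_mul, integral_finsetSum _ hintf,
    integral_finsetSum _ hintw] at hle
  have h1 : ∑ t ∈ Finset.Icc 1 T, ∫ ω, (largeMove init X β N t).indicator (fun _ => (1 : ℝ)) ω ∂μ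
      ≤ T * (4 * N * Real.exp (-b ^ 2 / 2)) := by
    refine (Finset.sum_le_card_nsmul _ _ (4 * N * Real.exp (-b ^ 2 / 2)) fun t _ => ?_).trans
      (by simp)
    rw [integral_indicator (h.measurableSet_largeMove β N t), setIntegral_const, smul_eq_mul,
      mul_one]
    exact h.measureReal_largeMove_le hσ hb.le N t
  have h2 : ∑ t ∈ Finset.Icc 1 T,
      ∫ ω, 10 * β ^ 2 * (1 / (β + |gain init X 0 t ω - gain init X 1 t ω|)) ∂μ
      ≤ T * (10 * β ^ 2 * (2 * Real.log ((β + 1) / β))) := by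
    refine (Finset.sum_le_card_nsmul _ _ (10 * β ^ 2 * (2 * Real.log ((β + 1) / β)))
      fun t _ => ?_).trans (by simp)
    rw [integral_const_mul]
    exact mul_le_mul_of_nonneg_left (h.integral_one_div_add_gap_le hβ t) (by positivity)
  simp only [integral_const, probReal_univ, one_smul] at hle
  linarith

lemma IsInput.avgRegret_mass_le (h : IsInput μ σ init X) {κ : ℝ} (hκ : 0 < κ) (hσ : 0 < σ)
    (hσ' : σ ≤ Real.exp (-1)) {T : ℕ} (hT : κ / σ ^ 2 ≤ T) {a : ℕ → Ω → Fin 2}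
    (ha : ∀ t, Measurable (a t))
    (hrun : ∀ ω, IsMASSRun (15 * σ * Real.log (1 / σ)) (fun i t => gain init X i t ω) T
      fun t => a t ω) :
    avgRegret μ (gain init X) T a ≤ (2 / κ + 9004) * (σ ^ 2 * Real.log (1 / σ) ^ 3) := by
  set L := Real.log (1 / σ) with hL
  have hLσ : L = -Real.log σ := by rw [hL, one_div, Real.log_inv]
  have hL1 : 1 ≤ L := by
    have := Real.log_le_log hσ hσ'
    rw [Real.log_exp] at this
    linarith
  have hexpL : Real.exp (-L) = σ := by rw [hLσ, neg_neg, Real.exp_log hσ]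
  have hT0 : (0 : ℝ) < T := lt_of_lt_of_le (by positivity) hT
  have hβ : 15 * σ * L = 15 * L * σ := by ring
  have hβσ : σ ≤ 15 * L * σ := by nlinarith
  set β := 15 * L * σ with hβdef
  have hβ0 : 0 < β := hσ.trans_le hβσ
  have hmain := h.integral_regretRV_le hσ (b := 15 * L) (by positivity) (N := ⌊1 / β ^ 2⌋₊)
    (T := T) (Nat.lt_floor_add_one _).le ha (fun ω => by rw [← hβdef, ← hβ]; exact hrun ω)
  rw [← hβdef] at hmain
  have hN : (⌊1 / β ^ 2⌋₊ : ℝ) ≤ 1 / σ ^ 2 :=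
    (Nat.floor_le (by positivity)).trans (by gcongr)
  -- Since `L ≥ 1`, the exponent satisfies `225 L² / 2 ≥ 4 L`. The power 4 absorbs the `σ⁻²` lags of
  -- the union bound.
  have hexp : Real.exp (-(15 * L) ^ 2 / 2) ≤ σ ^ 4 := by
    rw [← hexpL, ← Real.exp_nat_mul]
    refine Real.exp_le_exp.2 ?_
    push_cast
    nlinarith
  have hfail : 4 * (⌊1 / β ^ 2⌋₊ : ℝ) * Real.exp (-(15 * L) ^ 2 / 2) ≤ 4 * σ ^ 2 := by
    calc _ ≤ 4 * (1 / σ ^ 2) * σ ^ 4 := by gcongr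
      _ = _ := by field_simp
  have hlog : Real.log ((β + 1) / β) ≤ L := by
    refine Real.log_le_log (by positivity) ?_
    have he : Real.exp (-1) ≤ 1 / 2 := by
      rw [Real.exp_neg, ← one_div]
      exact one_div_le_one_div_of_le (by norm_num) (by linarith [Real.add_one_le_exp (1 : ℝ)])
    rw [div_le_div_iff₀ hβ0 hσ]
    have : 15 * σ ≤ β := by rw [hβdef]; nlinarith
    nlinarith
  have hTinv : 2 / (T : ℝ) ≤ 2 / κ * σ ^ 2 := by
    rw [div_le_iff₀ (by positivity)] at hT
    rw [div_le_iff₀ hT0]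
    have : 2 / κ * σ ^ 2 * T = 2 / κ * (T * σ ^ 2) := by ring
    rw [this]
    calc (2 : ℝ) = 2 / κ * κ := by field_simp
      _ ≤ _ := by gcongr
  have hL3 : σ ^ 2 ≤ σ ^ 2 * L ^ 3 := le_mul_of_one_le_right (by positivity) (one_le_pow₀ hL1)
  unfold avgRegret
  calc 1 / (T : ℝ) * ∫ ω, regretRV (gain init X) T a ω ∂μ
      ≤ 1 / (T : ℝ) * (2 + T * (4 * ⌊1 / β ^ 2⌋₊ * Real.exp (-(15 * L) ^ 2 / 2))
        + 40 * T * (β ^ 2 * Real.log ((β + 1) / β))) := by gcongr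
    _ = 2 / T + 4 * ⌊1 / β ^ 2⌋₊ * Real.exp (-(15 * L) ^ 2 / 2)
        + 40 * (β ^ 2 * Real.log ((β + 1) / β)) := by field_simp
    _ ≤ 2 / κ * σ ^ 2 + 4 * σ ^ 2 + 40 * (β ^ 2 * L) := by gcongr
    -- Here `9000 = 40 * 15²`, while `2 / κ` comes from the first two slots and `4` from the bad
    -- ones.
    _ = (2 / κ + 4) * σ ^ 2 + 9000 * (σ ^ 2 * L ^ 3) := by rw [hβdef]; ring
    _ ≤ (2 / κ + 4) * (σ ^ 2 * L ^ 3) + 9000 * (σ ^ 2 * L ^ 3) := by gcongr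
    _ = _ := by ring

end UpperBound

/-! ### The lower bound for online algorithms -/

section LowerBound

lemma measurable_online_choice {Ω : Type*} {S : Type*} {m : MeasurableSpace Ω}
    [MeasurableSpace S] {U : Ω → S} (hU : Measurable U) {J : Set ℕ}
    {φ : S × (J → Fin 2 × ℝ) → Fin 2} (hφ : Measurable φ) {c : J → Ω → Fin 2} {y : J → Ω → ℝ}
    (hc : ∀ s, Measurable (c s)) (hy : ∀ s, Measurable (y s)) :
    Measurable fun ω => φ (U ω, fun s => (c s ω, y s ω)) :=
  hφ.comp (hU.prodMk (measurable_pi_lambda _ fun s => (hc s).prodMk (hy s)))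

/-- The σ-algebra of the internal randomness `U` and of the inputs that determine the gains up to
slot `n`. -/
@[reducible] def histSigma {Ω : Type u} {S : Type v} [MeasurableSpace S] (U : Ω → S)
    (init : Fin 2 → Ω → ℝ) (X : Fin 2 → ℕ → Ω → ℝ) (n : ℕ) : MeasurableSpace Ω :=
  MeasurableSpace.comap U inferInstance ⊔ inputSigma init X (pastIdx n)

lemma histSigma_mono {Ω : Type u} {S : Type v} [MeasurableSpace S] (U : Ω → S)
    (init : Fin 2 → Ω → ℝ) (X : Fin 2 → ℕ → Ω → ℝ) {m n : ℕ} (h : m ≤ n) :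
    histSigma U init X m ≤ histSigma U init X n :=
  sup_le_sup_left (inputSigma_mono (pastIdx_mono h)) _

lemma measurable_gain_histSigma {Ω : Type u} {S : Type v} [MeasurableSpace S] (U : Ω → S)
    (init : Fin 2 → Ω → ℝ) (X : Fin 2 → ℕ → Ω → ℝ) (i : Fin 2) {s n : ℕ} (h : s ≤ n) :
    Measurable[histSigma U init X n] (gain init X i s) :=
  (measurable_gain_pastIdx h).mono le_sup_right le_rfl

/-- The choice in slot `n + 1` uses gains up to slot `n` only, and the earlier choices are covered
by strong induction. It is therefore determined before the increments at time `n` enter. -/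
lemma IsOnline.measurable_histSigma {Ω : Type u} {S : Type v} [MeasurableSpace S] {U : Ω → S}
    {init : Fin 2 → Ω → ℝ} {X : Fin 2 → ℕ → Ω → ℝ} {T : ℕ} {a : ℕ → Ω → Fin 2}
    (ha : IsOnline (gain init X) U T a) (n : ℕ) (hn : n + 1 ≤ T) :
    Measurable[histSigma U init X n] (a (n + 1)) := by
  induction n using Nat.strong_induction_on with
  | _ n ih =>
    obtain ⟨φ, hφ, e⟩ := ha (n + 1) (Finset.mem_Icc.2 ⟨by omega, hn⟩)
    rw [funext e]
    have hc : ∀ s : Set.Ico 1 (n + 1), Measurable[histSigma U init X n] (a s) := by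
      rintro ⟨s, hs1, hsn⟩
      obtain ⟨k, rfl⟩ := Nat.exists_eq_add_of_le' hs1
      exact (ih k (by omega) (by omega)).mono (histSigma_mono U init X (by omega)) le_rfl
    refine measurable_online_choice ?_ hφ hc fun s =>
      measurable_selected (G := fun i => gain init X i s)
        (fun i => measurable_gain_histSigma U init X i (by have := s.2.2; omega)) (hc s)
    exact (comap_measurable U).mono le_sup_left le_rfl

/-- As `2σ ≤ 1/4`, neither step leaves `[0,1]`, so no reflection occurs. The increments differ by
more than `2σ`, of which the initial difference can undo at most `σ`. -/
lemma le_reflect_add_sub_reflect_add {σ x y u v : ℝ} (hσ : σ ≤ 1 / 8)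
    (hx : x ∈ Set.Icc (1 / 4 : ℝ) (3 / 4)) (hy : y ∈ Set.Icc (1 / 4 : ℝ) (3 / 4))
    (hxy : |x - y| ≤ σ) (hu : u ∈ Set.Ioo σ (2 * σ)) (hv : v ∈ Set.Ioo (-(2 * σ)) (-σ)) :
    σ ≤ reflect (x + u) - reflect (y + v) := by
  obtain ⟨hx1, hx2⟩ := hx
  obtain ⟨hy1, hy2⟩ := hy
  obtain ⟨hu1, hu2⟩ := hu
  obtain ⟨hv1, hv2⟩ := hv
  have := abs_le.1 hxy
  rw [reflect_of_mem (by linarith) (by linarith), reflect_of_mem (by linarith) (by linarith)]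
  linarith

lemma gaussianReal_Ioo_scale {σ : ℝ} (hσ : 0 < σ) :
    gaussianReal 0 (σ ^ 2).toNNReal (Set.Ioo σ (2 * σ)) = gaussianReal 0 1 (Set.Ioo 1 2) := by
  have h := gaussianReal_map_const_mul (μ := 0) (v := 1) σ
  rw [mul_zero, mul_one] at h
  have e : NNReal.mk (σ ^ 2) (sq_nonneg σ) = (σ ^ 2).toNNReal :=
    NNReal.eq (Real.coe_toNNReal _ (sq_nonneg σ)).symm
  rw [e] at h
  rw [← h, Measure.map_apply (measurable_const_mul σ) measurableSet_Ioo]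
  congr 1
  ext x
  simp only [Set.mem_preimage, Set.mem_Ioo]
  constructor
  · rintro ⟨h1, h2⟩; constructor <;> nlinarith
  · rintro ⟨h1, h2⟩; constructor <;> nlinarith

lemma gaussianReal_Ioo_neg (v : NNReal) (x y : ℝ) :
    gaussianReal 0 v (Set.Ioo (-y) (-x)) = gaussianReal 0 v (Set.Ioo x y) := by
  have h := gaussianReal_map_neg (μ := 0) (v := v)
  rw [neg_zero] at h
  conv_lhs => rw [← h]
  rw [Measure.map_apply measurable_neg measurableSet_Ioo]
  simp

/-- Lebesgue measure is absolutely continuous with respect to the Gaussian law, so a null interval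
would have length zero. -/
lemma gaussianReal_Ioo_pos : 0 < (gaussianReal 0 1).real (Set.Ioo 1 2) := by
  refine ENNReal.toReal_pos (fun h => ?_) (measure_ne_top _ _)
  have := gaussianReal_absolutelyContinuous' 0 (v := 1) one_ne_zero h
  norm_num at this

lemma le_prod_near_diagonal {σ : ℝ} (hσ : 0 < σ) (hσ' : σ ≤ 1 / 8) :
    ENNReal.ofReal (σ / 4)
      ≤ ((volume.restrict (Set.Icc (0 : ℝ) 1)).prod (volume.restrict (Set.Icc (0 : ℝ) 1)))
        {p | p.1 ∈ Set.Icc (1 / 4 : ℝ) (3 / 4) ∧ p.2 ∈ Set.Icc (1 / 4 : ℝ) (3 / 4)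
          ∧ |p.1 - p.2| ≤ σ} := by
  have hm : MeasurableSet {p : ℝ × ℝ | p.1 ∈ Set.Icc (1 / 4 : ℝ) (3 / 4)
      ∧ p.2 ∈ Set.Icc (1 / 4 : ℝ) (3 / 4) ∧ |p.1 - p.2| ≤ σ} :=
    (measurable_fst measurableSet_Icc).inter ((measurable_snd measurableSet_Icc).inter
      (measurableSet_le (measurable_fst.sub measurable_snd).abs measurable_const))
  rw [Measure.prod_apply hm]
  -- The strip `x ∈ [1/4, 1/2]`, `y ∈ [x, x + σ]` lies in the set and has area `σ/4`.
  calc ENNReal.ofReal (σ / 4)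
      = ∫⁻ _ in Set.Icc (1 / 4 : ℝ) (1 / 2), ENNReal.ofReal σ := by
        rw [setLIntegral_const, Real.volume_Icc, ← ENNReal.ofReal_mul hσ.le]
        congr 1; ring
    _ ≤ ∫⁻ x in Set.Icc (1 / 4 : ℝ) (1 / 2), volume.restrict (Set.Icc (0 : ℝ) 1)
          (Prod.mk x ⁻¹' {p : ℝ × ℝ | p.1 ∈ Set.Icc (1 / 4 : ℝ) (3 / 4)
            ∧ p.2 ∈ Set.Icc (1 / 4 : ℝ) (3 / 4) ∧ |p.1 - p.2| ≤ σ}) := by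
        refine setLIntegral_mono' measurableSet_Icc fun x hx => ?_
        have hsub : Set.Icc x (x + σ) ⊆ (Prod.mk x ⁻¹' {p : ℝ × ℝ |
            p.1 ∈ Set.Icc (1 / 4 : ℝ) (3 / 4) ∧ p.2 ∈ Set.Icc (1 / 4 : ℝ) (3 / 4)
            ∧ |p.1 - p.2| ≤ σ}) := by
          intro y hy
          obtain ⟨hx1, hx2⟩ := hx
          obtain ⟨hy1, hy2⟩ := hy
          refine ⟨⟨hx1, by change x ≤ _; linarith⟩, ⟨by change _ ≤ y; linarith,
            by change y ≤ _; linarith⟩, ?_⟩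
          change |x - y| ≤ σ
          rw [abs_le]; constructor <;> linarith
        refine le_trans ?_ (measure_mono hsub)
        rw [Measure.restrict_apply measurableSet_Icc, Set.inter_eq_left.2
          (Set.Icc_subset_Icc (by linarith [hx.1]) (by linarith [hx.2])), Real.volume_Icc]
        rw [add_sub_cancel_left]
    _ ≤ _ := lintegral_mono' (Measure.restrict_mono
        (Set.Icc_subset_Icc (by norm_num) (by norm_num)) le_rfl) le_rfl

variable {Ω : Type u} [mΩ : MeasurableSpace Ω] {μ : Measure Ω} [IsProbabilityMeasure μ]
  {S : Type v} [MeasurableSpace S] {U : Ω → S}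
  {init : Fin 2 → Ω → ℝ} {X : Fin 2 → ℕ → Ω → ℝ} {σ : ℝ}

omit [IsProbabilityMeasure μ] in
lemma IsInput.histSigma_le (h : IsInput μ σ init X) (hU : Measurable U) (n : ℕ) :
    histSigma U init X n ≤ mΩ :=
  sup_le hU.comap_le (h.inputSigma_le _)

lemma IsInput.indep_histSigma (h : IsInput μ σ init X) (hU : Measurable U)
    (hind : IndepFun U (fun ω => ((fun i => init i ω), (fun i t => X i t ω))) μ) (n : ℕ) :
    Indep (histSigma U init X n) (inputSigma init X {p | ∃ i, p = Sum.inr (i, n)}) μ := by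
  have hle : ∀ I, inputSigma init X I ≤ MeasurableSpace.comap
      (fun ω => ((fun i => init i ω), (fun i t => X i t ω))) inferInstance := by
    intro I
    refine iSup₂_le fun p _ => ?_
    rw [← measurable_iff_comap_le]
    have hc := comap_measurable
      (m := (inferInstance : MeasurableSpace ((Fin 2 → ℝ) × (Fin 2 → ℕ → ℝ))))
      (fun ω => ((fun i => init i ω), (fun i t => X i t ω)))
    rcases p with i | ⟨i, t⟩
    · exact ((measurable_pi_apply i).comp measurable_fst).comp hc
    · exact ((measurable_pi_apply t).comp ((measurable_pi_apply i).comp measurable_snd)).comp hc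
  exact indep_sup_left hU.comap_le (h.inputSigma_le _) (h.inputSigma_le _)
    (indep_of_indep_of_le_right hind (sup_le (hle _) (hle _)))
    (h.indep_inputSigma (disjoint_pastIdx n))

lemma IsInput.measureReal_inter_increment (h : IsInput μ σ init X) (hU : Measurable U)
    (hind : IndepFun U (fun ω => ((fun i => init i ω), (fun i t => X i t ω))) μ) (hσ : 0 < σ)
    {n : ℕ} {A : Set Ω} (hA : MeasurableSet[histSigma U init X n] A) {i j : Fin 2} (hij : i ≠ j) :
    μ.real (A ∩ (X i n ⁻¹' Set.Ioo σ (2 * σ) ∩ X j n ⁻¹' Set.Ioo (-(2 * σ)) (-σ)))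
      = μ.real A * (gaussianReal 0 1).real (Set.Ioo 1 2) ^ 2 := by
  have hX : ∀ i, Measurable[inputSigma init X {p | ∃ i, p = Sum.inr (i, n)}] (X i n) := fun i =>
    measurable_inputs_inputSigma (p := Sum.inr (i, n)) ⟨i, rfl⟩
  have h1 := (Indep_iff _ _ _).1 (h.indep_histSigma hU hind n) A _ hA
    (((hX i) (measurableSet_Ioo (a := σ) (b := 2 * σ))).inter
      ((hX j) (measurableSet_Ioo (a := -(2 * σ)) (b := -σ))))
  have hXX : IndepFun (X i n) (X j n) μ :=
    h.indep.indepFun (i := Sum.inr (i, n)) (j := Sum.inr (j, n)) (by simpa using hij)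
  have h2 := hXX.measure_inter_preimage_eq_mul (Set.Ioo σ (2 * σ)) (Set.Ioo (-(2 * σ)) (-σ))
    measurableSet_Ioo measurableSet_Ioo
  have hlaw : ∀ i B, MeasurableSet B →
      μ (X i n ⁻¹' B) = gaussianReal 0 (σ ^ 2).toNNReal B := fun i B hB => by
    rw [← h.law_increment i n, Measure.map_apply (h.measurable_increment i n) hB]
  rw [hlaw i _ measurableSet_Ioo, hlaw j _ measurableSet_Ioo, gaussianReal_Ioo_neg,
    gaussianReal_Ioo_scale hσ] at h2
  rw [measureReal_def, h1, h2, ENNReal.toReal_mul, ENNReal.toReal_mul, measureReal_def,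
    measureReal_def, pow_two]

lemma IsInput.le_integral_slot_regret (h : IsInput μ σ init X) (hU : Measurable U)
    (hind : IndepFun U (fun ω => ((fun i => init i ω), (fun i t => X i t ω))) μ) (hσ : 0 < σ)
    (hσ' : σ ≤ 1 / 8) {n : ℕ} {b : Ω → Fin 2} (hb : Measurable[histSigma U init X n] b) :
    (gaussianReal 0 1).real (Set.Ioo 1 2) ^ 2 / 4 * σ ^ 2
      ≤ ∫ ω, (max (gain init X 0 (n + 1) ω) (gain init X 1 (n + 1) ω)
          - gain init X (b ω) (n + 1) ω) ∂μ := by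
  have hle := h.histSigma_le hU n
  set N : Set (ℝ × ℝ) := {p | p.1 ∈ Set.Icc (1 / 4 : ℝ) (3 / 4)
    ∧ p.2 ∈ Set.Icc (1 / 4 : ℝ) (3 / 4) ∧ |p.1 - p.2| ≤ σ} with hN
  have hNm : MeasurableSet N :=
    (measurable_fst measurableSet_Icc).inter ((measurable_snd measurableSet_Icc).inter
      (measurableSet_le (measurable_fst.sub measurable_snd).abs measurable_const))
  set A : Set Ω := (fun ω => (gain init X 0 n ω, gain init X 1 n ω)) ⁻¹' N with hA
  have hAm : MeasurableSet[histSigma U init X n] A :=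
    ((measurable_gain_histSigma U init X 0 le_rfl).prodMk
      (measurable_gain_histSigma U init X 1 le_rfl)) hNm
  have hAμ : σ / 4 ≤ μ.real A := by
    have := le_prod_near_diagonal hσ hσ'
    rw [← h.map_gain_prod n, Measure.map_apply
      ((h.measurable_gain 0 n).prodMk (h.measurable_gain 1 n)) hNm] at this
    exact (ENNReal.ofReal_le_iff_le_toReal (measure_ne_top _ _)).1 this
  have hBm : ∀ j, MeasurableSet[histSigma U init X n] (b ⁻¹' {j}) := fun j =>
    hb (measurableSet_singleton j)
  have hCm : ∀ j, MeasurableSet[histSigma U init X n] (A ∩ b ⁻¹' {j}) := fun j =>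
    MeasurableSet.inter hAm (hBm j)
  -- The second index is the scheduled CoV, whose gain falls. Its choice belongs to the history, so
  -- the increments remain independent of it.
  set E : Fin 2 → Fin 2 → Set Ω := fun i j =>
    (A ∩ b ⁻¹' {j}) ∩ (X i n ⁻¹' Set.Ioo σ (2 * σ) ∩ X j n ⁻¹' Set.Ioo (-(2 * σ)) (-σ)) with hE
  have hEm : ∀ i j, MeasurableSet (E i j) := fun i j =>
    (hle _ (hCm j)).inter ((h.measurable_increment i n measurableSet_Ioo).inter
      (h.measurable_increment j n measurableSet_Ioo))
  have hsum : μ.real (A ∩ b ⁻¹' {0}) + μ.real (A ∩ b ⁻¹' {1}) = μ.real A := by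
    have hc : A ∩ b ⁻¹' {1} = A \ b ⁻¹' {0} := by
      ext ω
      have : b ω = 1 ↔ ¬ b ω = 0 := by generalize b ω = x; revert x; decide
      simp [this]
    rw [hc]
    exact measureReal_inter_add_sdiff (hle _ (hBm 0))
  have hint : ∀ i j, Integrable ((E i j).indicator fun _ => σ) μ := fun i j =>
    (integrable_const σ).indicator (hEm i j)
  have hlow : ∫ ω, ((E 0 1).indicator (fun _ => σ) ω + (E 1 0).indicator (fun _ => σ) ω) ∂μ
      ≤ ∫ ω, (max (gain init X 0 (n + 1) ω) (gain init X 1 (n + 1) ω)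
          - gain init X (b ω) (n + 1) ω) ∂μ := by
    refine integral_mono ((hint 0 1).add (hint 1 0))
      (h.integrable_slot_regret (hb.mono hle le_rfl) (by omega)) fun ω => ?_
    have h01 : ω ∈ E 0 1 → σ ≤ gain init X 0 (n + 1) ω - gain init X 1 (n + 1) ω ∧ b ω = 1 :=
      fun ⟨⟨⟨hx, hy, hxy⟩, hbω⟩, hu, hv⟩ =>
        ⟨le_reflect_add_sub_reflect_add hσ' hx hy hxy hu hv, hbω⟩
    have h10 : ω ∈ E 1 0 → σ ≤ gain init X 1 (n + 1) ω - gain init X 0 (n + 1) ω ∧ b ω = 0 :=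
      fun ⟨⟨⟨hx, hy, hxy⟩, hbω⟩, hu, hv⟩ =>
        ⟨le_reflect_add_sub_reflect_add hσ' hy hx (by rw [abs_sub_comm]; exact hxy) hu hv, hbω⟩
    have hr := slot_regret_nonneg (fun i t => gain init X i t ω) (b ω) (n + 1)
    simp only at hr ⊢
    by_cases m1 : ω ∈ E 0 1
    · have m2 : ω ∉ E 1 0 := fun m2 => by
        have e1 := (h01 m1).2
        have e2 := (h10 m2).2
        rw [e1] at e2
        exact absurd e2 (by decide)
      rw [Set.indicator_of_mem m1, Set.indicator_of_notMem m2, (h01 m1).2]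
      linarith [(h01 m1).1, le_max_left (gain init X 0 (n + 1) ω) (gain init X 1 (n + 1) ω)]
    · rw [Set.indicator_of_notMem m1]
      by_cases m2 : ω ∈ E 1 0
      · rw [Set.indicator_of_mem m2, (h10 m2).2]
        linarith [(h10 m2).1, le_max_right (gain init X 0 (n + 1) ω) (gain init X 1 (n + 1) ω)]
      · rw [Set.indicator_of_notMem m2]
        linarith
  refine le_trans ?_ hlow
  rw [integral_add (hint 0 1) (hint 1 0), integral_indicator (hEm 0 1),
    integral_indicator (hEm 1 0), setIntegral_const, setIntegral_const,
    h.measureReal_inter_increment hU hind hσ (hCm 1) (by decide),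
    h.measureReal_inter_increment hU hind hσ (hCm 0) (by decide), smul_eq_mul, smul_eq_mul]
  calc (gaussianReal 0 1).real (Set.Ioo 1 2) ^ 2 / 4 * σ ^ 2
      = σ / 4 * ((gaussianReal 0 1).real (Set.Ioo 1 2) ^ 2 * σ) := by ring
    _ ≤ μ.real A * ((gaussianReal 0 1).real (Set.Ioo 1 2) ^ 2 * σ) := by gcongr
    _ = _ := by rw [← hsum]; ring

lemma IsInput.le_avgRegret_online (h : IsInput μ σ init X) (hU : Measurable U)
    (hind : IndepFun U (fun ω => ((fun i => init i ω), (fun i t => X i t ω))) μ) (hσ : 0 < σ)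
    (hσ' : σ ≤ 1 / 8) {T : ℕ} (hT : 1 ≤ T) {a : ℕ → Ω → Fin 2}
    (ha : IsOnline (gain init X) U T a) :
    (gaussianReal 0 1).real (Set.Ioo 1 2) ^ 2 / 4 * σ ^ 2 ≤ avgRegret μ (gain init X) T a := by
  have hT0 : (0 : ℝ) < T := by exact_mod_cast hT
  have hmeas : ∀ t ∈ Finset.Icc 1 T, Measurable[histSigma U init X (t - 1)] (a t) := by
    intro t ht
    rw [Finset.mem_Icc] at ht
    obtain ⟨n, rfl⟩ := Nat.exists_eq_add_of_le' ht.1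
    exact ha.measurable_histSigma n ht.2
  have hsum : ∫ ω, regretRV (gain init X) T a ω ∂μ = ∑ t ∈ Finset.Icc 1 T,
      ∫ ω, (max (gain init X 0 t ω) (gain init X 1 t ω) - gain init X (a t ω) t ω) ∂μ :=
    integral_finsetSum _ fun t ht => h.integrable_slot_regret
      ((hmeas t ht).mono (h.histSigma_le hU _) le_rfl) (Finset.mem_Icc.1 ht).1
  have hge := Finset.card_nsmul_le_sum (Finset.Icc 1 T)
    (fun t => ∫ ω, (max (gain init X 0 t ω) (gain init X 1 t ω) - gain init X (a t ω) t ω) ∂μ)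
    ((gaussianReal 0 1).real (Set.Ioo 1 2) ^ 2 / 4 * σ ^ 2) (fun t ht => by
      obtain ⟨n, rfl⟩ := Nat.exists_eq_add_of_le' (Finset.mem_Icc.1 ht).1
      exact h.le_integral_slot_regret hU hind hσ hσ' (hmeas _ ht))
  rw [← hsum, Nat.card_Icc, Nat.add_sub_cancel, nsmul_eq_mul] at hge
  unfold avgRegret
  rw [one_div, ← div_eq_inv_mul, le_div_iff₀' hT0]
  exact hge

end LowerBound

end MASS

open MASS MeasureTheory ProbabilityTheory in
theorem theorem1 :
    -- MASS with `β = 15 σ log (1/σ)` and `T ≥ κ σ⁻²` has regret `O(σ² log³ (1/σ))` as `σ → 0`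
    (∀ κ : ℝ, 0 < κ → ∃ C : ℝ, 0 < C ∧ ∃ σ₀ : ℝ, 0 < σ₀ ∧ σ₀ < 1 ∧
      ∀ (Ω : Type u) [MeasurableSpace Ω] (μ : Measure Ω) [IsProbabilityMeasure μ]
        (σ : ℝ) (init : Fin 2 → Ω → ℝ) (X : Fin 2 → ℕ → Ω → ℝ)
        (T : ℕ) (a : ℕ → Ω → Fin 2),
        0 < σ → σ ≤ σ₀ → κ / σ ^ 2 ≤ (T : ℝ) →
        IsInput μ σ init X →
        (∀ t, Measurable (a t)) →
        (∀ ω, IsMASSRun (15 * σ * Real.log (1 / σ)) (fun i t => gain init X i t ω) T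
          (fun t => a t ω)) →
        Integrable (regretRV (gain init X) T a) μ ∧
        avgRegret μ (gain init X) T a ≤ C * (σ ^ 2 * Real.log (1 / σ) ^ 3)) ∧
    -- every (possibly randomized) online algorithm has regret `Ω(σ²)`
    (∃ c : ℝ, 0 < c ∧ ∃ σ₀ : ℝ, 0 < σ₀ ∧ σ₀ < 1 ∧
      ∀ (Ω : Type u) [MeasurableSpace Ω] (μ : Measure Ω) [IsProbabilityMeasure μ]
        (S : Type v) [MeasurableSpace S] (U : Ω → S)
        (σ : ℝ) (init : Fin 2 → Ω → ℝ) (X : Fin 2 → ℕ → Ω → ℝ)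
        (T : ℕ) (a : ℕ → Ω → Fin 2),
        0 < σ → σ ≤ σ₀ → 1 ≤ T →
        IsInput μ σ init X →
        Measurable U →
        IndepFun U (fun ω => ((fun i => init i ω), (fun i t => X i t ω))) μ →
        IsOnline (gain init X) U T a →
        c * σ ^ 2 ≤ avgRegret μ (gain init X) T a) := by
  -- The threshold `exp (-1)` makes `log (1/σ) ≥ 1`; the threshold `1/8` keeps the steps of the
  -- lower bound inside `[0,1]`.
  refine ⟨fun κ hκ => ⟨2 / κ + 9004, by positivity, Real.exp (-1), Real.exp_pos _,
    Real.exp_zero ▸ Real.exp_lt_exp.2 (by norm_num), ?_⟩,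
    ⟨(gaussianReal 0 1).real (Set.Ioo 1 2) ^ 2 / 4,
      div_pos (pow_pos gaussianReal_Ioo_pos 2) (by norm_num), 1 / 8, by norm_num, by norm_num, ?_⟩⟩
  · intro Ω _ μ _ σ init X T a hσ hσ' hT h ha hrun
    exact ⟨h.integrable_regretRV fun t _ => ha t, h.avgRegret_mass_le hκ hσ hσ' hT ha hrun⟩
  · intro Ω _ μ _ S _ U σ init X T a hσ hσ' hT h hU hind ha
    exact h.le_avgRegret_online hU hind hσ hσ' hT ha
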